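/- Let $n\in\mathbb N$, $D=2n$, $\theta\in\mathbb R\setminus\{0\}$ and $\Theta=\theta\,\mathrm{diag}(J,\dots,J)$ with $n$ blocks $J=\begin{pmatrix}0&-1\\1&0\end{pmatrix}$. Let $\mathcal S=\mathcal S(\mathbb R^D)$ be the space of complex-valued Schwartz functions and $\mathcal S'$ the space of tempered distributions, with $\mathcal S\subset\mathcal S'$ through $\langle a,b\rangle=\int ab$. For $a,b\in\mathcal S$ let $$(a\star b)(x)=\frac1{(\pi\theta)^D}\int d^Dy\,d^Dz\;a(x+y)\,b(x+z)\,e^{-2i\,y\Theta^{-1}z},$$ and for $T\in\mathcal S'$, $a\in\mathcal S$ define $T\star a,\ a\star T\in\mathcal S'$ by $\langle T\star a,b\rangle=\langle T,a\star b\rangle$ and $\langle a\star T,b\rangle=\langle T,b\star a\rangle$ for $b\in\mathcal S$. The Moyal algebra is $$\mathcal M=\{T\in\mathcal S' : T\star a\in\mathcal S\text{ and }a\star T\in\mathcal S\text{ for all }a\in\mathcal S\},$$ with the product $\langle T\star S,b\rangle=\langle T,S\star b\rangle$ ($T,S\in\mathcal M$, $b\in\mathcal S$), the unit $1$ (the constant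 function, $\langle 1,b\rangle=\int b$) and the natural involution $\langle T^\dagger,a\rangle=\overline{\langle T,\overline a\rangle}$. Then $T\star S$ is a well-defined element of $\mathcal M$ for all $T,S\in\mathcal M$. Moreover, consider the $\mathbb Z_2$-graded vector space $\mathbb A^\bullet=\mathcal M^0\oplus\mathcal M^1$, where $\mathcal M^0$ and $\mathcal M^1$ are two copies of $\mathcal M$ in degrees $0$ and $1$, with $$ab=(a_0\star b_0+a_1\star b_1,\;a_0\star b_1+a_1\star b_0),\qquad a^\dagger=(a_0^\dagger,\,i\,a_1^\dagger)$$ for $a=(a_0,a_1)$, $b=(b_0,b_1)$. Then $\mathbb A^\bullet$ is a $\mathbb Z_2$-graded associative $*$-algebra over $\mathbb C$ with unit $(1,0)$: the product is bilinear, associative, has unit $(1,0)$ and satisfies $\mathbb A^\alpha\mathbb A^\beta\subseteq\mathbb A^{\alpha+\beta}$; the map $\dagger$ is antilinear, involutive and preserves the degree, and $(ab)^\dagger=(-1)^{|a||b|}b^\dagger a^\dagger$ for homogeneous $a,b$. Its center $\mathcal Z(\mathbb A^\bullet)=\{a\in\mathbb A^\bullet : [a,b]_\bullet=0\text{ for all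 }b\in\mathbb A^\bullet\}$, where $[a,b]_\bullet$ is the graded bracket, i.e. the bilinear extension of $[a,b]_\bullet=ab-(-1)^{|a||b|}ba$ from homogeneous elements, is $\mathbb C\oplus 0=\{(c\cdot 1,0) : c\in\mathbb C\}$. -/

import Mathlib

noncomputable section
namespace Moyal

set_option maxSynthPendingDepth 3
set_option linter.unusedSectionVars false
open scoped SchwartzMap ComplexConjugate FourierTransform ContDiff
open MeasureTheory

section Oscillatory

variable {E : Type} [NormedAddCommGroup E] [InnerProductSpace ℝ E] [FiniteDimensional ℝ E]
  [MeasurableSpace E] [BorelSpace E]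

/-- The oscillatory integral `x ↦ ∫ e^{i ⟨N y, x⟩} L (a (x + y)) (B y) dy`, an auxiliary tool to show
that the Moyal product of two Schwartz functions is a Schwartz function. -/
def osc (N : E →L[ℝ] E) {F G H : Type} [NormedAddCommGroup F] [NormedSpace ℝ F]
    [NormedAddCommGroup G] [NormedSpace ℝ G]
    [NormedAddCommGroup H] [NormedSpace ℝ H] [NormedSpace ℂ H]
    (L : F →L[ℝ] G →L[ℝ] H) (a : 𝓢(E, F)) (B : 𝓢(E, G)) (x : E) : H :=
  ∫ y, Complex.exp (((inner ℝ (N y) x : ℝ) : ℂ) * Complex.I) • L (a (x + y)) (B y)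

theorem norm_osc_integrand (N : E →L[ℝ] E) {H : Type}
    [NormedAddCommGroup H]  [NormedSpace ℂ H] (x y : E) (h : H) :
    ‖Complex.exp (((inner ℝ (N y) x : ℝ) : ℂ) * Complex.I) • h‖ = ‖h‖ := by
  rw [norm_smul, Complex.norm_exp_ofReal_mul_I, one_mul]

theorem osc_integrable (N : E →L[ℝ] E) {F G H : Type} [NormedAddCommGroup F] [NormedSpace ℝ F]
    [NormedAddCommGroup G] [NormedSpace ℝ G]
    [NormedAddCommGroup H] [NormedSpace ℝ H] [NormedSpace ℂ H]
    (L : F →L[ℝ] G →L[ℝ] H) (a : 𝓢(E, F)) (B : 𝓢(E, G)) (x : E) :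
    Integrable (fun y => Complex.exp (((inner ℝ (N y) x : ℝ) : ℂ) * Complex.I) •
      L (a (x + y)) (B y)) := by
  have hB : Integrable (fun y => ‖L‖ * SchwartzMap.seminorm ℝ 0 0 a * ‖B y‖) :=
    B.integrable.norm.const_mul _
  refine hB.mono' ?_ (.of_forall fun y => ?_)
  · refine Continuous.aestronglyMeasurable ?_
    have := a.continuous
    have := B.continuous
    fun_prop
  · rw [norm_osc_integrand]
    refine (L.le_opNorm₂ _ _).trans ?_
    gcongr
    exact a.norm_le_seminorm ℝ _

theorem osc_hasFDerivAt (N : E →L[ℝ] E) {F G H : Type} [NormedAddCommGroup F] [NormedSpace ℝ F]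
    [NormedAddCommGroup G] [NormedSpace ℝ G]
    [NormedAddCommGroup H] [NormedSpace ℝ H] [NormedSpace ℂ H] [IsScalarTower ℝ ℂ H]
    (L : F →L[ℝ] G →L[ℝ] H) (a : 𝓢(E, F)) (B : 𝓢(E, G)) (x : E) :
    HasFDerivAt (osc N L a B)
      (osc N (L.precompL E) (SchwartzMap.fderivCLM ℝ E F a) B x +
       osc N ((Complex.I • L).precompR E) a
        (SchwartzMap.smulRightCLM ℝ G ((innerSL ℝ).comp N) B) x) x := by
  set a' := SchwartzMap.fderivCLM ℝ E F a with ha'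
  set B' := SchwartzMap.smulRightCLM ℝ G ((innerSL ℝ).comp N) B with hB'
  have e1 := osc_integrable N (L.precompL E) a' B x
  have e2 := osc_integrable N ((Complex.I • L).precompR E) a B' x
  unfold osc
  rw [← integral_add e1 e2]
  refine hasFDerivAt_integral_of_dominated_of_fderiv_le (𝕜 := ℝ)
    (bound := fun y => ‖L.precompL E‖ * SchwartzMap.seminorm ℝ 0 0 a' * ‖B y‖ +
      ‖(Complex.I • L).precompR E‖ * SchwartzMap.seminorm ℝ 0 0 a * ‖B' y‖)
    (F' := fun x y => Complex.exp (((inner ℝ (N y) x : ℝ) : ℂ) * Complex.I) •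
        L.precompL E (a' (x + y)) (B y) +
      Complex.exp (((inner ℝ (N y) x : ℝ) : ℂ) * Complex.I) •
        (Complex.I • L).precompR E (a (x + y)) (B' y)) Filter.univ_mem
    (.of_forall fun x => (osc_integrable N L a B x).aestronglyMeasurable)
    (osc_integrable N L a B x) (e1.add e2).aestronglyMeasurable
    (.of_forall fun y x _ => ?_) ?_ (.of_forall fun y x _ => ?_)
  · refine (norm_add_le _ _).trans ?_
    rw [norm_osc_integrand, norm_osc_integrand]
    refine add_le_add ((ContinuousLinearMap.le_opNorm₂ _ _ _).trans ?_)
      ((ContinuousLinearMap.le_opNorm₂ _ _ _).trans ?_) <;> gcongr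
    · exact a'.norm_le_seminorm ℝ _
    · exact a.norm_le_seminorm ℝ _
  · exact (B.integrable.norm.const_mul _).add (B'.integrable.norm.const_mul _)
  · have h1 : HasFDerivAt (fun x : E => a (x + y)) (a' (x + y)) x := by
      have := (a.differentiableAt (x := x + y)).hasFDerivAt
      exact this.comp x ((hasFDerivAt_id x).add_const y)
    have h2 : HasFDerivAt (fun x : E => L (a (x + y)) (B y))
        ((L.flip (B y)).comp (a' (x + y))) x :=
      (L.flip (B y)).hasFDerivAt.comp x h1
    have h3 : HasFDerivAt (fun x : E => Complex.exp (((inner ℝ (N y) x : ℝ) : ℂ) * Complex.I))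
        (Complex.exp (((inner ℝ (N y) x : ℝ) : ℂ) * Complex.I) •
          ((Complex.ofRealCLM.comp (innerSL ℝ (N y))).smulRight Complex.I)) x := by
      have h4 : HasFDerivAt (fun x : E => ((inner ℝ (N y) x : ℝ) : ℂ) * Complex.I)
          ((Complex.ofRealCLM.comp (innerSL ℝ (N y))).smulRight Complex.I) x :=
        ((Complex.ofRealCLM.comp (innerSL ℝ (N y))).smulRight Complex.I).hasFDerivAt
      exact h4.cexp
    convert h3.smul h2 using 1
    · rfl
    · ext v
      have hB1 : B' y = (innerSL ℝ (N y)).smulRight (B y) := rfl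
      simp only [hB1, ContinuousLinearMap.precompL_apply, ContinuousLinearMap.precompR_apply,
        add_apply, smul_apply,
        ContinuousLinearMap.smulRight_apply, ContinuousLinearMap.comp_apply,
        ContinuousLinearMap.flip_apply, innerSL_apply_apply, Complex.ofRealCLM_apply]
      have h5 : ((ContinuousLinearMap.compL ℝ E G H (Complex.I • L (a (x + y))))
          ((innerSL ℝ (N y)).smulRight (B y))) v =
          Complex.I • (inner ℝ (N y) v : ℝ) • L (a (x + y)) (B y) := by
        change (Complex.I • L (a (x + y))) ((inner ℝ (N y) v : ℝ) • B y) = _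
        rw [smul_apply, map_smul]
      have h6 : ∀ (r : ℝ) (h : H), r • h = (r : ℂ) • h := fun r h => by
        rw [← algebraMap_smul ℂ r h]; rfl
      rw [h5, h6]
      simp only [smul_smul, smul_eq_mul]
      ring_nf

theorem osc_contDiff (N : E →L[ℝ] E) (m : ℕ) : ∀ {F G H : Type} [NormedAddCommGroup F]
    [NormedSpace ℝ F] [NormedAddCommGroup G] [NormedSpace ℝ G]
    [NormedAddCommGroup H] [NormedSpace ℝ H] [NormedSpace ℂ H] [IsScalarTower ℝ ℂ H]
    (L : F →L[ℝ] G →L[ℝ] H) (a : 𝓢(E, F)) (B : 𝓢(E, G)), ContDiff ℝ m (osc N L a B) := by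
  induction m with
  | zero =>
    intro F G H _ _ _ _ _ _ _ _ L a B
    refine contDiff_zero.2 (continuous_iff_continuousAt.2 fun x => ?_)
    exact (osc_hasFDerivAt N L a B x).continuousAt
  | succ m ih =>
    intro F G H _ _ _ _ _ _ _ _ L a B
    have hd : ∀ x, HasFDerivAt (osc N L a B) _ x := osc_hasFDerivAt N L a B
    rw [show ((m + 1 : ℕ) : WithTop ℕ∞) = (m : WithTop ℕ∞) + 1 by push_cast; rfl,
      contDiff_succ_iff_fderiv]
    refine ⟨fun x => (hd x).differentiableAt, by simp, ?_⟩
    rw [funext fun x => (hd x).fderiv]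
    exact (ih _ _ _).add (ih _ _ _)

theorem osc_bound (N : E →L[ℝ] E) (k m : ℕ) : ∀ {F G H : Type} [NormedAddCommGroup F]
    [NormedSpace ℝ F] [NormedAddCommGroup G] [NormedSpace ℝ G]
    [NormedAddCommGroup H] [NormedSpace ℝ H] [NormedSpace ℂ H] [IsScalarTower ℝ ℂ H]
    (L : F →L[ℝ] G →L[ℝ] H), ∃ (p : Seminorm ℝ 𝓢(E, F)) (q : Seminorm ℝ 𝓢(E, G)),
    Continuous p ∧ Continuous q ∧ ∀ (a : 𝓢(E, F)) (B : 𝓢(E, G)) (x : E),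
      ‖x‖ ^ k * ‖iteratedFDeriv ℝ m (osc N L a B) x‖ ≤ p a * q B := by
  have hc : ∀ {F : Type} [NormedAddCommGroup F] [NormedSpace ℝ F] (i j : ℕ),
      Continuous (SchwartzMap.seminorm ℝ i j : Seminorm ℝ 𝓢(E, F)) := fun i j =>
    (schwartz_withSeminorms ℝ E _).continuous_seminorm (i, j)
  induction m with
  | zero =>
    intro F G H _ _ _ _ _ _ _ _ L
    set r := (volume : Measure E).integrablePower
    set K : ℝ := 2 ^ r * (∫ x : E, (1 + ‖x‖) ^ (-(r : ℝ))) with hK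
    have hK0 : 0 ≤ K := by positivity
    refine ⟨SchwartzMap.seminorm ℝ k 0 + SchwartzMap.seminorm ℝ 0 0,
      (‖L‖ * 2 ^ k * K).toNNReal • (SchwartzMap.seminorm ℝ 0 0 + SchwartzMap.seminorm ℝ r 0 +
        (SchwartzMap.seminorm ℝ 0 0 + SchwartzMap.seminorm ℝ (k + r) 0)), ?_, ?_, ?_⟩
    · exact (hc k 0).add (hc 0 0)
    · exact (((hc 0 0).add (hc r 0)).add ((hc 0 0).add (hc (k + r) 0))).const_smul
        (‖L‖ * 2 ^ k * K).toNNReal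
    · intro a B x
      rw [norm_iteratedFDeriv_zero]
      have hI0 := SchwartzMap.integral_pow_mul_iteratedFDeriv_le ℝ (volume : Measure E) B 0 0
      have hIk := SchwartzMap.integral_pow_mul_iteratedFDeriv_le ℝ (volume : Measure E) B k 0
      simp only [norm_iteratedFDeriv_zero, pow_zero, one_mul, zero_add] at hI0 hIk
      set A0 := SchwartzMap.seminorm ℝ 0 0 a
      set Ak := SchwartzMap.seminorm ℝ k 0 a
      have hA0 : 0 ≤ A0 := apply_nonneg _ _
      have hAk : 0 ≤ Ak := apply_nonneg _ _
      have hint : Integrable (fun y => ‖L‖ * 2 ^ k * (Ak * ‖B y‖ + A0 * (‖y‖ ^ k * ‖B y‖))) :=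
        ((B.integrable.norm.const_mul _).add
          ((B.integrable_pow_mul volume k).const_mul _)).const_mul _
      calc ‖x‖ ^ k * ‖osc N L a B x‖ = ‖(‖x‖ ^ k : ℝ) • osc N L a B x‖ := by
            rw [norm_smul]; simp
        _ ≤ ∫ y, ‖L‖ * 2 ^ k * (Ak * ‖B y‖ + A0 * (‖y‖ ^ k * ‖B y‖)) := by
            unfold osc
            rw [← integral_smul]
            refine norm_integral_le_of_norm_le hint (.of_forall fun y => ?_)
            rw [norm_smul, norm_osc_integrand, norm_pow, norm_norm]
            have h1 : ‖x‖ ^ k ≤ 2 ^ k * (‖x + y‖ ^ k + ‖y‖ ^ k) := by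
              have h2 : ‖x‖ ≤ ‖x + y‖ + ‖y‖ := by
                simpa using norm_sub_le (x + y) y
              calc ‖x‖ ^ k ≤ (‖x + y‖ + ‖y‖) ^ k := by gcongr
                _ ≤ 2 ^ (k - 1) * (‖x + y‖ ^ k + ‖y‖ ^ k) :=
                    add_pow_le (norm_nonneg _) (norm_nonneg _) _
                _ ≤ _ := by
                    gcongr
                    · norm_num
                    · omega
            have h3 : ‖x + y‖ ^ k * ‖a (x + y)‖ ≤ Ak := a.norm_pow_mul_le_seminorm ℝ k _
            have h4 : ‖a (x + y)‖ ≤ A0 := a.norm_le_seminorm ℝ _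
            calc ‖x‖ ^ k * ‖L (a (x + y)) (B y)‖
                ≤ (2 ^ k * (‖x + y‖ ^ k + ‖y‖ ^ k)) * (‖L‖ * ‖a (x + y)‖ * ‖B y‖) := by
                  gcongr
                  exact L.le_opNorm₂ _ _
              _ = ‖L‖ * 2 ^ k * ((‖x + y‖ ^ k * ‖a (x + y)‖) * ‖B y‖ +
                    ‖a (x + y)‖ * (‖y‖ ^ k * ‖B y‖)) := by ring
              _ ≤ _ := by gcongr
        _ = ‖L‖ * 2 ^ k * (Ak * (∫ y, ‖B y‖) + A0 * ∫ y, ‖y‖ ^ k * ‖B y‖) := by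
            rw [integral_const_mul, integral_add (B.integrable.norm.const_mul _)
              ((B.integrable_pow_mul volume k).const_mul _), integral_const_mul,
              integral_const_mul]
        _ ≤ ‖L‖ * 2 ^ k * (Ak * (K * (SchwartzMap.seminorm ℝ 0 0 B +
              SchwartzMap.seminorm ℝ r 0 B)) + A0 * (K * (SchwartzMap.seminorm ℝ 0 0 B +
              SchwartzMap.seminorm ℝ (k + r) 0 B))) := by gcongr
        _ ≤ (Ak + A0) * ((‖L‖ * 2 ^ k * K) * ((SchwartzMap.seminorm ℝ 0 0 B +
              SchwartzMap.seminorm ℝ r 0 B) + (SchwartzMap.seminorm ℝ 0 0 B +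
              SchwartzMap.seminorm ℝ (k + r) 0 B))) := by
            have s1 : 0 ≤ SchwartzMap.seminorm ℝ 0 0 B + SchwartzMap.seminorm ℝ r 0 B := by
              positivity
            have s2 : 0 ≤ SchwartzMap.seminorm ℝ 0 0 B + SchwartzMap.seminorm ℝ (k + r) 0 B := by
              positivity
            set S1 := SchwartzMap.seminorm ℝ 0 0 B + SchwartzMap.seminorm ℝ r 0 B
            set S2 := SchwartzMap.seminorm ℝ 0 0 B + SchwartzMap.seminorm ℝ (k + r) 0 B
            have hM : 0 ≤ ‖L‖ * 2 ^ k * K := by positivity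
            have : 0 ≤ (‖L‖ * 2 ^ k * K) * (Ak * S2 + A0 * S1) := by positivity
            linarith
        _ = _ := by
            have hM : 0 ≤ ‖L‖ * 2 ^ k * K := by positivity
            simp [NNReal.smul_def, Real.coe_toNNReal _ hM, Ak, A0]
            exact Or.inl (by ring)
  | succ m ih =>
    intro F G H _ _ _ _ _ _ _ _ L
    obtain ⟨p1, q1, hp1, hq1, h1⟩ := ih (L.precompL E)
    obtain ⟨p2, q2, hp2, hq2, h2⟩ := ih ((Complex.I • L).precompR E)
    set D := SchwartzMap.fderivCLM ℝ E F
    set S := SchwartzMap.smulRightCLM ℝ (E := E) G ((innerSL ℝ).comp N)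
    refine ⟨p1.comp D.toLinearMap + p2, q1 + q2.comp S.toLinearMap,
      (hp1.comp D.continuous).add hp2, hq1.add (hq2.comp S.continuous), fun a B x => ?_⟩
    have hd : ∀ x, HasFDerivAt (osc N L a B) _ x := osc_hasFDerivAt N L a B
    rw [← norm_iteratedFDeriv_fderiv, funext fun x => (hd x).fderiv]
    have hadd := iteratedFDeriv_add_apply (𝕜 := ℝ) (i := m) (x := x)
      (osc_contDiff N m (L.precompL E) (D a) B).contDiffAt
      (osc_contDiff N m ((Complex.I • L).precompR E) a (S B)).contDiffAt
    have hle : ‖x‖ ^ k * ‖iteratedFDeriv ℝ m (osc N (L.precompL E) (D a) B +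
        osc N ((Complex.I • L).precompR E) a (S B)) x‖ ≤
        p1 (D a) * q1 B + p2 a * q2 (S B) := by
      rw [hadd]
      calc _ ≤ ‖x‖ ^ k * (‖iteratedFDeriv ℝ m (osc N (L.precompL E) (D a) B) x‖ +
            ‖iteratedFDeriv ℝ m (osc N ((Complex.I • L).precompR E) a (S B)) x‖) := by
            gcongr; exact norm_add_le _ _
        _ ≤ _ := by
            rw [mul_add]
            exact add_le_add (h1 _ _ _) (h2 _ _ _)
    refine hle.trans ?_
    have e1 : 0 ≤ p1 (D a) := apply_nonneg _ _
    have e2 : 0 ≤ p2 a := apply_nonneg _ _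
    have e3 : 0 ≤ q1 B := apply_nonneg _ _
    have e4 : 0 ≤ q2 (S B) := apply_nonneg _ _
    change _ ≤ (p1 (D a) + p2 a) * (q1 B + q2 (S B))
    nlinarith [mul_nonneg e1 e4, mul_nonneg e2 e3]

end Oscillatory

/-- The space `ℝ^D`, `D = 2n`; the coordinate `(i, k)` is the `i`-th coordinate of the `k`-th plane. -/
abbrev Space (n : ℕ) : Type := EuclideanSpace ℝ (Fin 2 × Fin n)

/-- `Θ = θ Σ` with `Σ = diag(J, …, J)`, `n` blocks `J = (0 -1; 1 0)`. -/
def Theta (n : ℕ) (θ : ℝ) : Matrix (Fin 2 × Fin n) (Fin 2 × Fin n) ℝ :=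
  θ • Matrix.blockDiagonal fun _ : Fin n => !![0, -1; 1, 0]

/-- The number `y Θ⁻¹ z`. -/
def thetaInvForm (n : ℕ) (θ : ℝ) (y z : Space n) : ℝ :=
  y.ofLp ⬝ᵥ ((Theta n θ)⁻¹).mulVec z.ofLp

/-- The function `x ↦ (π θ)^{-D} ∫∫ a (x + y) b (x + z) e^{-2 i y Θ⁻¹ z} dy dz`. -/
def moyalIntegral (n : ℕ) (θ : ℝ) (a b : 𝓢(Space n, ℂ)) (x : Space n) : ℂ :=
  1 / ((Real.pi * θ : ℝ) : ℂ) ^ (2 * n) *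
    ∫ y : Space n, ∫ z : Space n,
      a (x + y) * b (x + z) * Complex.exp (-Complex.I * 2 * (thetaInvForm n θ y z : ℝ))

theorem isUnit_Theta (n : ℕ) (θ : ℝ) [NeZero θ] : IsUnit (Theta n θ) := by
  have h : Theta n θ *
      (θ⁻¹ • Matrix.blockDiagonal fun _ : Fin n => (!![0, 1; -1, 0] : Matrix _ _ ℝ)) = 1 := by
    rw [Theta, Matrix.smul_mul, Matrix.mul_smul, smul_smul, mul_inv_cancel₀ (NeZero.ne θ),
      one_smul, ← Matrix.blockDiagonal_mul, ← Matrix.blockDiagonal_one]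
    congr 1
    ext k i j
    fin_cases i <;> fin_cases j <;> simp
  exact (Matrix.isUnit_iff_isUnit_det _).2 (Matrix.isUnit_det_of_right_inverse h)

theorem exists_momentumMap (n : ℕ) (θ : ℝ) [NeZero θ] : ∃ M : Space n ≃L[ℝ] Space n,
    ∀ y z : Space n, inner ℝ (M y) z = Real.pi⁻¹ * thetaInvForm n θ y z := by
  have h1 : IsUnit (Real.pi⁻¹ • ((Theta n θ)⁻¹).transpose) := by
    have h2 : IsUnit ((Theta n θ)⁻¹).transpose := by
      rw [Matrix.isUnit_transpose, Matrix.isUnit_nonsing_inv_iff]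
      exact isUnit_Theta n θ
    exact h2.smul (Units.mk0 _ (inv_ne_zero Real.pi_ne_zero))
  obtain ⟨u, hu⟩ := h1.map (Matrix.toEuclideanCLM (n := Fin 2 × Fin n) (𝕜 := ℝ))
  refine ⟨ContinuousLinearEquiv.unitsEquiv ℝ (Space n) u, fun y z => ?_⟩
  change inner ℝ ((u : Space n →L[ℝ] Space n) y) z = _
  rw [hu, real_inner_comm, Matrix.inner_toEuclideanCLM, thetaInvForm, Matrix.smul_mulVec,
    dotProduct_smul, smul_eq_mul, Matrix.mulVec_transpose, dotProduct_comm,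
    ← Matrix.dotProduct_mulVec]

theorem exists_moyalIntegral_eq (n : ℕ) (θ : ℝ) [NeZero θ] :
    ∃ (c : ℂ) (N : Space n →L[ℝ] Space n) (T : 𝓢(Space n, ℂ) →L[ℂ] 𝓢(Space n, ℂ)),
      ∀ a b : 𝓢(Space n, ℂ), moyalIntegral n θ a b =
        c • osc N (ContinuousLinearMap.mul ℝ ℂ) a (T b) := by
  obtain ⟨M, hM⟩ := exists_momentumMap n θ
  refine ⟨1 / ((Real.pi * θ : ℝ) : ℂ) ^ (2 * n), (2 * Real.pi) • (M : Space n →L[ℝ] Space n),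
    (SchwartzMap.compCLMOfContinuousLinearEquiv ℂ M).comp
      (FourierTransform.fourierCLM ℂ 𝓢(Space n, ℂ)), fun a b => ?_⟩
  funext x
  rw [moyalIntegral, Pi.smul_apply, osc, smul_eq_mul]
  congr 1
  refine integral_congr_ae (.of_forall fun y => ?_)
  have h1 : (SchwartzMap.compCLMOfContinuousLinearEquiv ℂ M).comp
      (FourierTransform.fourierCLM ℂ 𝓢(Space n, ℂ)) b y = 𝓕 (b : Space n → ℂ) (M y) := rfl
  change (∫ z : Space n,
      a (x + y) * b (x + z) * Complex.exp (-Complex.I * 2 * (thetaInvForm n θ y z : ℝ))) =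
    _ • (a (x + y) * _)
  rw [h1, Real.fourier_eq']
  rw [← integral_add_left_eq_self (fun v : Space n =>
      Complex.exp (((-2 * Real.pi * inner ℝ v (M y) : ℝ) : ℂ) * Complex.I) • b v) x, ← integral_const_mul, smul_eq_mul, ← integral_const_mul]
  refine integral_congr_ae (.of_forall fun z => ?_)
  have h2 : inner ℝ (((2 * Real.pi) • (M : Space n →L[ℝ] Space n)) y) x =
      2 * thetaInvForm n θ y x := by
    change inner ℝ ((2 * Real.pi) • M y) x = _
    rw [real_inner_smul_left, hM]
    field_simp
  have h3 : inner ℝ (x + z) (M y) = Real.pi⁻¹ * (thetaInvForm n θ y x + thetaInvForm n θ y z) := by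
    rw [inner_add_left, real_inner_comm, hM, real_inner_comm, hM]
    ring
  simp only [h2, h3, smul_eq_mul]
  have h4 : Complex.exp (-Complex.I * 2 * (thetaInvForm n θ y z : ℝ)) =
      Complex.exp (((2 * thetaInvForm n θ y x : ℝ) : ℂ) * Complex.I) *
      Complex.exp (((-2 * Real.pi * (Real.pi⁻¹ * (thetaInvForm n θ y x + thetaInvForm n θ y z)) :
        ℝ) : ℂ) * Complex.I) := by
    rw [← Complex.exp_add]
    congr 1
    have hpi : (Real.pi : ℂ) ≠ 0 := by exact_mod_cast Real.pi_ne_zero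
    push_cast
    field_simp
    ring
  rw [h4]
  ring

/-- The Moyal product `a ⋆ b` of two Schwartz functions. -/
def moyalStar (n : ℕ) (θ : ℝ) [NeZero θ] (a b : 𝓢(Space n, ℂ)) : 𝓢(Space n, ℂ) where
  toFun := moyalIntegral n θ a b
  smooth' := by
    obtain ⟨c, N, T, h⟩ := exists_moyalIntegral_eq n θ
    rw [h, contDiff_infty]
    exact fun m => contDiff_const.smul (osc_contDiff N m _ a (T b))
  decay' := fun k m => by
    obtain ⟨c, N, T, h⟩ := exists_moyalIntegral_eq n θ
    obtain ⟨p, q, -, -, hpq⟩ := osc_bound N k m (ContinuousLinearMap.mul ℝ ℂ)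
    refine ⟨‖c‖ * (p a * q (T b)), fun x => ?_⟩
    rw [h, iteratedFDeriv_const_smul_apply (osc_contDiff N m _ a (T b)).contDiffAt, norm_smul,
      mul_left_comm]
    exact mul_le_mul_of_nonneg_left (hpq a (T b) x) (norm_nonneg c)

theorem moyalStar_seminorm_le {n : ℕ} {θ : ℝ} [NeZero θ] {c : ℂ} {N : Space n →L[ℝ] Space n}
    {T : 𝓢(Space n, ℂ) →L[ℂ] 𝓢(Space n, ℂ)} (h : ∀ a b : 𝓢(Space n, ℂ),
      moyalIntegral n θ a b = c • osc N (ContinuousLinearMap.mul ℝ ℂ) a (T b)) {k m : ℕ}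
    {p q : Seminorm ℝ 𝓢(Space n, ℂ)} (hpq : ∀ (a B : 𝓢(Space n, ℂ)) (x : Space n),
      ‖x‖ ^ k * ‖iteratedFDeriv ℝ m (osc N (ContinuousLinearMap.mul ℝ ℂ) a B) x‖ ≤ p a * q B)
    (a b : 𝓢(Space n, ℂ)) :
    SchwartzMap.seminorm ℝ k m (moyalStar n θ a b) ≤ ‖c‖ * p a * q (T b) := by
  refine SchwartzMap.seminorm_le_bound ℝ k m _ (by positivity) fun x => ?_
  change ‖x‖ ^ k * ‖iteratedFDeriv ℝ m (moyalIntegral n θ a b) x‖ ≤ _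
  rw [h, iteratedFDeriv_const_smul_apply (osc_contDiff N m _ a (T b)).contDiffAt, norm_smul,
    mul_left_comm, mul_assoc]
  exact mul_le_mul_of_nonneg_left (hpq a (T b) x) (norm_nonneg c)

theorem moyalStar_add_left (n : ℕ) (θ : ℝ) [NeZero θ] (a a' b : 𝓢(Space n, ℂ)) :
    moyalStar n θ (a + a') b = moyalStar n θ a b + moyalStar n θ a' b := by
  obtain ⟨c, N, T, h⟩ := exists_moyalIntegral_eq n θ
  ext x
  change moyalIntegral n θ (a + a') b x = moyalIntegral n θ a b x + moyalIntegral n θ a' b x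
  simp only [h, Pi.smul_apply, osc, ← smul_add]
  rw [← integral_add (osc_integrable _ _ _ _ _) (osc_integrable _ _ _ _ _)]
  congr 2
  ext y
  simp [mul_add]

theorem moyalStar_add_right (n : ℕ) (θ : ℝ) [NeZero θ] (a b b' : 𝓢(Space n, ℂ)) :
    moyalStar n θ a (b + b') = moyalStar n θ a b + moyalStar n θ a b' := by
  obtain ⟨c, N, T, h⟩ := exists_moyalIntegral_eq n θ
  ext x
  change moyalIntegral n θ a (b + b') x = moyalIntegral n θ a b x + moyalIntegral n θ a b' x
  simp only [h, Pi.smul_apply, osc, ← smul_add]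
  rw [← integral_add (osc_integrable _ _ _ _ _) (osc_integrable _ _ _ _ _)]
  congr 2
  ext y
  simp [mul_add]

theorem moyalStar_smul_left (n : ℕ) (θ : ℝ) [NeZero θ] (r : ℂ) (a b : 𝓢(Space n, ℂ)) :
    moyalStar n θ (r • a) b = r • moyalStar n θ a b := by
  ext x
  change moyalIntegral n θ (r • a) b x = r * moyalIntegral n θ a b x
  simp only [moyalIntegral]
  rw [mul_left_comm, ← integral_const_mul]
  simp_rw [← integral_const_mul]
  simp [mul_assoc]

theorem moyalStar_smul_right (n : ℕ) (θ : ℝ) [NeZero θ] (r : ℂ) (a b : 𝓢(Space n, ℂ)) :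
    moyalStar n θ a (r • b) = r • moyalStar n θ a b := by
  ext x
  change moyalIntegral n θ a (r • b) x = r * moyalIntegral n θ a b x
  simp only [moyalIntegral]
  rw [mul_left_comm, ← integral_const_mul]
  simp_rw [← integral_const_mul]
  simp [mul_assoc, mul_left_comm]

/-- The operator `b ↦ a ⋆ b` of left multiplication by `a` on the Schwartz space. -/
def starLeft (n : ℕ) (θ : ℝ) [NeZero θ] (a : 𝓢(Space n, ℂ)) :
    𝓢(Space n, ℂ) →L[ℂ] 𝓢(Space n, ℂ) where
  toFun b := moyalStar n θ a b
  map_add' := moyalStar_add_right n θ a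
  map_smul' r b := moyalStar_smul_right n θ r a b
  cont := by
    obtain ⟨c, N, T, h⟩ := exists_moyalIntegral_eq n θ
    let A : 𝓢(Space n, ℂ) →ₗ[ℝ] 𝓢(Space n, ℂ) :=
      { toFun := fun b => moyalStar n θ a b
        map_add' := moyalStar_add_right n θ a
        map_smul' := fun r b => moyalStar_smul_right n θ (r : ℂ) a b }
    change Continuous A
    refine (schwartz_withSeminorms ℝ (Space n) ℂ).continuous_of_continuous_comp A fun ⟨k, m⟩ => ?_
    obtain ⟨p, q, -, hq, hpq⟩ := osc_bound N k m (ContinuousLinearMap.mul ℝ ℂ)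
    let T' : 𝓢(Space n, ℂ) →ₗ[ℝ] 𝓢(Space n, ℂ) := T.toLinearMap.restrictScalars ℝ
    have hT : Continuous T' := T.continuous
    have hq' : Continuous ((‖c‖ * p a).toNNReal • q.comp T') :=
      (hq.comp hT).const_smul (‖c‖ * p a).toNNReal
    refine Seminorm.continuous_of_le hq' fun b => ?_
    have hpa : 0 ≤ ‖c‖ * p a := mul_nonneg (norm_nonneg _) (apply_nonneg _ _)
    have hle : SchwartzMap.seminorm ℝ k m (moyalStar n θ a b) ≤ ‖c‖ * p a * q (T b) :=
      moyalStar_seminorm_le h hpq a b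
    refine hle.trans_eq (Eq.symm ?_)
    change ((‖c‖ * p a).toNNReal : ℝ) * q (T b) = _
    rw [Real.coe_toNNReal _ hpa]

/-- The operator `a ↦ a ⋆ b` of right multiplication by `b` on the Schwartz space. -/
def starRight (n : ℕ) (θ : ℝ) [NeZero θ] (b : 𝓢(Space n, ℂ)) :
    𝓢(Space n, ℂ) →L[ℂ] 𝓢(Space n, ℂ) where
  toFun a := moyalStar n θ a b
  map_add' a a' := moyalStar_add_left n θ a a' b
  map_smul' r a := moyalStar_smul_left n θ r a b
  cont := by
    obtain ⟨c, N, T, h⟩ := exists_moyalIntegral_eq n θ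
    let A : 𝓢(Space n, ℂ) →ₗ[ℝ] 𝓢(Space n, ℂ) :=
      { toFun := fun a => moyalStar n θ a b
        map_add' := fun a a' => moyalStar_add_left n θ a a' b
        map_smul' := fun r a => moyalStar_smul_left n θ (r : ℂ) a b }
    change Continuous A
    refine (schwartz_withSeminorms ℝ (Space n) ℂ).continuous_of_continuous_comp A fun ⟨k, m⟩ => ?_
    obtain ⟨p, q, hp, -, hpq⟩ := osc_bound N k m (ContinuousLinearMap.mul ℝ ℂ)
    have hp' : Continuous ((‖c‖ * q (T b)).toNNReal • p) :=
      hp.const_smul (‖c‖ * q (T b)).toNNReal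
    refine Seminorm.continuous_of_le hp' fun a => ?_
    have hpa : 0 ≤ ‖c‖ * q (T b) := mul_nonneg (norm_nonneg _) (apply_nonneg _ _)
    have hle : SchwartzMap.seminorm ℝ k m (moyalStar n θ a b) ≤ ‖c‖ * q (T b) * p a :=
      (moyalStar_seminorm_le h hpq a b).trans (by rw [mul_right_comm])
    refine hle.trans_eq (Eq.symm ?_)
    change ((‖c‖ * q (T b)).toNNReal : ℝ) * p a = _
    rw [Real.coe_toNNReal _ hpa]


/-- The canonical embedding `𝓢 ⊂ 𝓢'`, `⟨a, b⟩ = ∫ a b`. -/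
def toDist {n : ℕ} (a : 𝓢(Space n, ℂ)) : 𝓢'(Space n, ℂ) :=
  SchwartzMap.toTemperedDistributionCLM (Space n) ℂ volume a

/-- `T ⋆ a` for `T ∈ 𝓢'` and `a ∈ 𝓢`: `⟨T ⋆ a, b⟩ = ⟨T, a ⋆ b⟩`. -/
def distStar (n : ℕ) (θ : ℝ) [NeZero θ] (T : 𝓢'(Space n, ℂ)) (a : 𝓢(Space n, ℂ)) :
    𝓢'(Space n, ℂ) :=
  PointwiseConvergenceCLM.precomp ℂ (starLeft n θ a) T

/-- `a ⋆ T` for `a ∈ 𝓢` and `T ∈ 𝓢'`: `⟨a ⋆ T, b⟩ = ⟨T, b ⋆ a⟩`. -/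
def starDist (n : ℕ) (θ : ℝ) [NeZero θ] (a : 𝓢(Space n, ℂ)) (T : 𝓢'(Space n, ℂ)) :
    𝓢'(Space n, ℂ) :=
  PointwiseConvergenceCLM.precomp ℂ (starRight n θ a) T

theorem distStar_apply (n : ℕ) (θ : ℝ) [NeZero θ] (T : 𝓢'(Space n, ℂ)) (a b : 𝓢(Space n, ℂ)) :
    distStar n θ T a b = T (moyalStar n θ a b) := rfl

theorem starDist_apply (n : ℕ) (θ : ℝ) [NeZero θ] (a : 𝓢(Space n, ℂ)) (T : 𝓢'(Space n, ℂ))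
    (b : 𝓢(Space n, ℂ)) : starDist n θ a T b = T (moyalStar n θ b a) := rfl

/-- `M_L = {T ∈ 𝓢' | a ⋆ T ∈ 𝓢 for all a ∈ 𝓢}`. -/
def multL (n : ℕ) (θ : ℝ) [NeZero θ] : Submodule ℂ 𝓢'(Space n, ℂ) where
  carrier := {T | ∀ a, ∃ c : 𝓢(Space n, ℂ), starDist n θ a T = toDist c}
  zero_mem' a := ⟨0, by simp only [starDist, toDist, map_zero]⟩
  add_mem' hT hS a := by
    obtain ⟨c, hc⟩ := hT a
    obtain ⟨d, hd⟩ := hS a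
    exact ⟨c + d, by simp only [starDist, toDist, map_add] at *; rw [hc, hd]⟩
  smul_mem' r T hT a := by
    obtain ⟨c, hc⟩ := hT a
    exact ⟨r • c, by simp only [starDist, toDist, map_smul] at *; rw [hc]⟩

/-- `M_R = {T ∈ 𝓢' | T ⋆ a ∈ 𝓢 for all a ∈ 𝓢}`. -/
def multR (n : ℕ) (θ : ℝ) [NeZero θ] : Submodule ℂ 𝓢'(Space n, ℂ) where
  carrier := {T | ∀ a, ∃ c : 𝓢(Space n, ℂ), distStar n θ T a = toDist c}
  zero_mem' a := ⟨0, by simp only [distStar, toDist, map_zero]⟩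
  add_mem' hT hS a := by
    obtain ⟨c, hc⟩ := hT a
    obtain ⟨d, hd⟩ := hS a
    exact ⟨c + d, by simp only [distStar, toDist, map_add] at *; rw [hc, hd]⟩
  smul_mem' r T hT a := by
    obtain ⟨c, hc⟩ := hT a
    exact ⟨r • c, by simp only [distStar, toDist, map_smul] at *; rw [hc]⟩

/-- The Moyal algebra `M = M_L ∩ M_R`, as a subspace of `𝓢'`. -/
def moyalAlgebra (n : ℕ) (θ : ℝ) [NeZero θ] : Submodule ℂ 𝓢'(Space n, ℂ) :=
  multL n θ ⊓ multR n θ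

open Classical in
/-- The product of `M`: for `S ∈ M_R`, `T ⋆ S` is the unique tempered distribution with
`⟨T ⋆ S, b⟩ = ⟨T, S ⋆ b⟩` for all `b ∈ 𝓢` (here `S ⋆ b ∈ 𝓢`); a default value is used when no
such distribution exists. -/
def moyalMul (n : ℕ) (θ : ℝ) [NeZero θ] (T S : 𝓢'(Space n, ℂ)) : 𝓢'(Space n, ℂ) :=
  if h : ∃ R : 𝓢'(Space n, ℂ), ∀ b c : 𝓢(Space n, ℂ), distStar n θ S b = toDist c → R b = T c
  then h.choose else 0

/-- The constant function `1` as a tempered distribution: `⟨1, b⟩ = ∫ b`. -/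
def oneDist (n : ℕ) : 𝓢'(Space n, ℂ) :=
  (volume : Measure (Space n)).toTemperedDistribution

/-- Complex conjugation on the Schwartz space. -/
def schwartzConj {n : ℕ} : 𝓢(Space n, ℂ) →L[ℝ] 𝓢(Space n, ℂ) :=
  SchwartzMap.postcompCLM (Complex.conjCLE : ℂ →L[ℝ] ℂ)

/-- The involution of `𝓢'`, dual to complex conjugation: `⟨T†, a⟩ = conj ⟨T, a†⟩`. -/
def distConj {n : ℕ} (T : 𝓢'(Space n, ℂ)) : 𝓢'(Space n, ℂ) :=
  ContinuousLinearMap.toPointwiseConvergenceCLM ℂ (RingHom.id ℂ) 𝓢(Space n, ℂ) ℂ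
    { toFun := fun a => conj (T (schwartzConj a))
      map_add' := fun a b => by simp
      map_smul' := fun r a => by
        have h : schwartzConj (r • a) = conj r • schwartzConj a := by
          ext x
          simp [schwartzConj]
        simp [h]
      cont := Complex.continuous_conj.comp (T.continuous.comp schwartzConj.continuous) }

theorem distConj_apply {n : ℕ} (T : 𝓢'(Space n, ℂ)) (a : 𝓢(Space n, ℂ)) :
    distConj T a = conj (T (schwartzConj a)) := rfl

/-- The homogeneous subspaces of `M⁰ ⊕ M¹`, realised inside `𝓢' × 𝓢'`: degree `0` is `M ⊕ 0` and
degree `1` is `0 ⊕ M`. -/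
def superGrading (n : ℕ) (θ : ℝ) [NeZero θ] (i : ZMod 2) :
    Submodule ℂ (𝓢'(Space n, ℂ) × 𝓢'(Space n, ℂ)) :=
  if i = 0 then (moyalAlgebra n θ).prod ⊥ else (⊥ : Submodule ℂ 𝓢'(Space n, ℂ)).prod
    (moyalAlgebra n θ)

/-- The underlying space of `M⁰ ⊕ M¹`. -/
def superMoyal (n : ℕ) (θ : ℝ) [NeZero θ] : Submodule ℂ (𝓢'(Space n, ℂ) × 𝓢'(Space n, ℂ)) :=
  (moyalAlgebra n θ).prod (moyalAlgebra n θ)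

/-- The product `a b = (a₀ ⋆ b₀ + a₁ ⋆ b₁, a₀ ⋆ b₁ + a₁ ⋆ b₀)`. -/
def superMul (n : ℕ) (θ : ℝ) [NeZero θ] (a b : 𝓢'(Space n, ℂ) × 𝓢'(Space n, ℂ)) :
    𝓢'(Space n, ℂ) × 𝓢'(Space n, ℂ) :=
  (moyalMul n θ a.1 b.1 + moyalMul n θ a.2 b.2, moyalMul n θ a.1 b.2 + moyalMul n θ a.2 b.1)

/-- The involution `a† = (a₀†, i a₁†)`. -/
def superDagger {n : ℕ} (a : 𝓢'(Space n, ℂ) × 𝓢'(Space n, ℂ)) :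
    𝓢'(Space n, ℂ) × 𝓢'(Space n, ℂ) :=
  (distConj a.1, Complex.I • distConj a.2)

/-- The unit `(1, 0)`. -/
def superOne (n : ℕ) : 𝓢'(Space n, ℂ) × 𝓢'(Space n, ℂ) := (oneDist n, 0)

/-- The subspace `A` of `V` with homogeneous parts `𝒜 0`, `𝒜 1` is a `ℤ/2`-graded associative unital
`*`-algebra over `ℂ` for the given product, unit and involution. As usual in the graded setting the
involution obeys `(a b)† = (-1)^{|a||b|} b† a†` for homogeneous `a`, `b`. -/
structure IsGradedStarAlgebra {V : Type*} [AddCommGroup V] [Module ℂ V] (A : Submodule ℂ V)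
    (𝒜 : ZMod 2 → Submodule ℂ V) (mul : V → V → V) (one : V) (dag : V → V) : Prop where
  iSup_eq : ⨆ i, 𝒜 i = A
  independent : iSupIndep 𝒜
  mul_mem : ∀ i j, ∀ a ∈ 𝒜 i, ∀ b ∈ 𝒜 j, mul a b ∈ 𝒜 (i + j)
  mul_mem' : ∀ a ∈ A, ∀ b ∈ A, mul a b ∈ A
  add_mul : ∀ a ∈ A, ∀ b ∈ A, ∀ c ∈ A, mul (a + b) c = mul a c + mul b c
  mul_add : ∀ a ∈ A, ∀ b ∈ A, ∀ c ∈ A, mul a (b + c) = mul a b + mul a c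
  smul_mul : ∀ r : ℂ, ∀ a ∈ A, ∀ b ∈ A, mul (r • a) b = r • mul a b
  mul_smul : ∀ r : ℂ, ∀ a ∈ A, ∀ b ∈ A, mul a (r • b) = r • mul a b
  mul_assoc : ∀ a ∈ A, ∀ b ∈ A, ∀ c ∈ A, mul (mul a b) c = mul a (mul b c)
  one_mem : one ∈ 𝒜 0
  one_mul : ∀ a ∈ A, mul one a = a
  mul_one : ∀ a ∈ A, mul a one = a
  dag_mem : ∀ i, ∀ a ∈ 𝒜 i, dag a ∈ 𝒜 i
  dag_mem' : ∀ a ∈ A, dag a ∈ A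
  dag_add : ∀ a ∈ A, ∀ b ∈ A, dag (a + b) = dag a + dag b
  dag_smul : ∀ r : ℂ, ∀ a ∈ A, dag (r • a) = conj r • dag a
  dag_dag : ∀ a ∈ A, dag (dag a) = a
  dag_mul : ∀ i j : ZMod 2, ∀ a ∈ 𝒜 i, ∀ b ∈ 𝒜 j,
    dag (mul a b) = (-1 : ℂ) ^ (i.val * j.val) • mul (dag b) (dag a)

/-- The homogeneous component of degree `i` of `a = (a₀, a₁)`. -/
def superPart {n : ℕ} (i : ZMod 2) (a : 𝓢'(Space n, ℂ) × 𝓢'(Space n, ℂ)) :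
    𝓢'(Space n, ℂ) × 𝓢'(Space n, ℂ) :=
  if i = 0 then (a.1, 0) else (0, a.2)

/-- The graded bracket, i.e. the biadditive extension of `[a, b] = a b - (-1)^{|a||b|} b a`
from homogeneous elements. -/
def superBracket (n : ℕ) (θ : ℝ) [NeZero θ] (a b : 𝓢'(Space n, ℂ) × 𝓢'(Space n, ℂ)) :
    𝓢'(Space n, ℂ) × 𝓢'(Space n, ℂ) :=
  ∑ i : ZMod 2, ∑ j : ZMod 2, (superMul n θ (superPart i a) (superPart j b) -
    (-1 : ℂ) ^ (i.val * j.val) • superMul n θ (superPart j b) (superPart i a))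

/-- The center of the graded algebra: the elements whose graded bracket with every element
vanishes. -/
def superCenter (n : ℕ) (θ : ℝ) [NeZero θ] : Set (𝓢'(Space n, ℂ) × 𝓢'(Space n, ℂ)) :=
  {a | a ∈ superMoyal n θ ∧ ∀ b ∈ superMoyal n θ, superBracket n θ a b = 0}

end Moyal
end

noncomputable section
namespace Moyal

set_option maxSynthPendingDepth 3
open scoped SchwartzMap ComplexConjugate FourierTransform ContDiff
open MeasureTheory

/-! ### The symplectic form -/

/-! Carrying out the `z`-integral turns the product into `(a ⋆ b)(x) = c ∫ e^{2i yΘ⁻¹x} a(x+y) b̂(y)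
dy`, where `b̂` is the Fourier transform for the antisymmetric form `yΘ⁻¹z` and `c` is exactly its
inversion constant. Fubini and `yΘ⁻¹y = 0` then give associativity (`moyalStar_assoc`) and the trace
identity `∫ a ⋆ b = ∫ ab` (`integral_moyalStar`). Hence `⟨a ⋆ b, c⟩ = ⟨a, b ⋆ c⟩ = ⟨b, c ⋆ a⟩`, and
the algebraic laws pass to multipliers by duality, once elements of `𝓢'` are known to be determined
by their values on star products.

The analytic difficulty is that `b ↦ ⟨T, S ⋆ b⟩` must be continuous, although `b ↦ S ⋆ b` is not
given as a continuous map. Widely dilated functions `e_j` with `e_j(0) = 1` satisfy `a ⋆ e_j → a` in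
`𝓢` (`exists_right_approxUnit`), because `a ⋆ b - b(0) a` is controlled by first absolute moments of
`b̂`, which shrink under dilation. Therefore `⟨T, S ⋆ b⟩ = lim ⟨T, (S ⋆ b) ⋆ e_j⟩ = lim ⟨S, b ⋆ (e_j
⋆ T)⟩` is a pointwise limit of continuous functionals. Since `𝓢` is complete and metrizable, hence
Baire, Banach–Steinhaus makes the limit continuous (`exists_dist_eq_apply_leftAct`). The same
approximate unit shows that star products are dense in `𝓢`.

For the center, the bracket with the odd unit `(0, 1)` has even component `2 a₁`, so `a₁ = 0`;
brackets with even elements say that `T = a₀` commutes with `𝓜`. Star multiplication by the plane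
wave `e^{2i hΘ⁻¹x}` is modulation by it combined with translation by `h` (from the right) or by `-h`
(from the left). The operator `a ↦ T ⋆ a` commutes with right multiplications by associativity and
with left ones because `T` is central; composing the two kinds isolates pure modulations and pure
translations. Commuting with modulations forces `(T ⋆ a) b = a (T ⋆ b)` pointwise, and commuting
with translations makes the multiplier constant, so `T ⋆ a = c a` and `T = c · 1`. -/

theorem Theta_transpose (n : ℕ) (θ : ℝ) : (Theta n θ).transpose = -Theta n θ := by
  ext ⟨i, k⟩ ⟨j, l⟩
  simp only [Theta, Matrix.transpose_apply, Matrix.smul_apply, Matrix.neg_apply,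
    Matrix.blockDiagonal_apply]
  fin_cases i <;> fin_cases j <;> by_cases h : k = l <;> simp [h, eq_comm]

theorem det_Theta (n : ℕ) (θ : ℝ) : (Theta n θ).det = θ ^ (2 * n) := by
  rw [Theta, Matrix.det_smul, Matrix.det_blockDiagonal]
  simp [Matrix.det_fin_two]

section Form

variable (n : ℕ) (θ : ℝ) [NeZero θ]

/-- A linear automorphism `M` with `⟨M y, z⟩ = π⁻¹ y Θ⁻¹ z`. -/
def momentumMap : Space n ≃L[ℝ] Space n := (exists_momentumMap n θ).choose

theorem inner_momentumMap (y z : Space n) :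
    inner ℝ (momentumMap n θ y) z = Real.pi⁻¹ * thetaInvForm n θ y z :=
  (exists_momentumMap n θ).choose_spec y z

theorem thetaInvForm_eq_inner (y z : Space n) :
    thetaInvForm n θ y z = Real.pi * inner ℝ (momentumMap n θ y) z := by
  rw [inner_momentumMap, mul_inv_cancel_left₀ Real.pi_ne_zero]

theorem thetaInvForm_add_right (x y z : Space n) :
    thetaInvForm n θ x (y + z) = thetaInvForm n θ x y + thetaInvForm n θ x z := by
  simp only [thetaInvForm_eq_inner, inner_add_right, mul_add]

theorem thetaInvForm_sub_left (x y z : Space n) :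
    thetaInvForm n θ (x - y) z = thetaInvForm n θ x z - thetaInvForm n θ y z := by
  simp only [thetaInvForm_eq_inner, map_sub, inner_sub_left, mul_sub]

theorem thetaInvForm_sub_right (x y z : Space n) :
    thetaInvForm n θ x (y - z) = thetaInvForm n θ x y - thetaInvForm n θ x z := by
  simp only [thetaInvForm_eq_inner, inner_sub_right, mul_sub]

theorem thetaInvForm_smul_left (r : ℝ) (y z : Space n) :
    thetaInvForm n θ (r • y) z = r * thetaInvForm n θ y z := by
  simp only [thetaInvForm_eq_inner, map_smul, real_inner_smul_left]
  ring

theorem thetaInvForm_smul_right (r : ℝ) (y z : Space n) :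
    thetaInvForm n θ y (r • z) = r * thetaInvForm n θ y z := by
  simp only [thetaInvForm_eq_inner, real_inner_smul_right]
  ring

theorem thetaInvForm_swap (y z : Space n) :
    thetaInvForm n θ z y = -thetaInvForm n θ y z := by
  have h : ((Theta n θ)⁻¹).transpose = -(Theta n θ)⁻¹ := by
    rw [Matrix.transpose_nonsing_inv, Theta_transpose]
    have := isUnit_Theta n θ
    refine Matrix.inv_eq_left_inv ?_
    rw [neg_mul_neg, Matrix.nonsing_inv_mul _ ((Matrix.isUnit_iff_isUnit_det _).1 this)]
  rw [thetaInvForm, thetaInvForm, dotProduct_comm, ← Matrix.vecMul_transpose, h,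
    Matrix.dotProduct_mulVec, Matrix.vecMul_neg, neg_dotProduct]

@[simp]
theorem thetaInvForm_self (y : Space n) : thetaInvForm n θ y y = 0 := by
  have := thetaInvForm_swap n θ y y
  linarith

@[simp]
theorem thetaInvForm_zero_right (y : Space n) : thetaInvForm n θ y 0 = 0 := by
  simp [thetaInvForm_eq_inner]

theorem thetaInvForm_neg_left (y z : Space n) :
    thetaInvForm n θ (-y) z = -thetaInvForm n θ y z := by
  simp [thetaInvForm_eq_inner]

@[fun_prop]
theorem continuous_thetaInvForm {X : Type*} [TopologicalSpace X] {f g : X → Space n}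
    (hf : Continuous f) (hg : Continuous g) :
    Continuous fun x => thetaInvForm n θ (f x) (g x) := by
  simp only [thetaInvForm_eq_inner]
  fun_prop

/-- The normalisation `(π θ)^{-D}` of the Moyal product. -/
def moyalConst : ℝ := ((Real.pi * θ) ^ (2 * n))⁻¹

theorem moyalConst_pos : 0 < moyalConst n θ := by
  have : Real.pi * θ ≠ 0 := mul_ne_zero Real.pi_ne_zero (NeZero.ne θ)
  rw [moyalConst, pow_mul]
  positivity

/-- The determinant is `π^{-D} det Θ⁻¹ = (πθ)^{-D}`. The normalisation of the product is thus the
Jacobian that Fourier inversion needs. -/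
theorem det_momentumMap :
    LinearMap.det ((momentumMap n θ : Space n →L[ℝ] Space n) : Space n →ₗ[ℝ] Space n) =
      moyalConst n θ := by
  have h : ((momentumMap n θ : Space n →L[ℝ] Space n) : Space n →ₗ[ℝ] Space n) =
      Matrix.toLpLin 2 2 (Real.pi⁻¹ • ((Theta n θ)⁻¹).transpose) := by
    refine LinearMap.ext fun y => ext_inner_right ℝ fun z => ?_
    refine (inner_momentumMap n θ y z).trans ?_
    have h2 : Matrix.toLpLin 2 2 (Real.pi⁻¹ • ((Theta n θ)⁻¹).transpose) y =
      Matrix.toEuclideanCLM (𝕜 := ℝ) (Real.pi⁻¹ • ((Theta n θ)⁻¹).transpose) y := rfl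
    rw [h2, real_inner_comm, Matrix.inner_toEuclideanCLM, thetaInvForm, Matrix.smul_mulVec,
      dotProduct_smul, smul_eq_mul, Matrix.mulVec_transpose, dotProduct_comm (z.ofLp),
      ← Matrix.dotProduct_mulVec]
  rw [h, LinearMap.det_toLpLin, Matrix.det_smul, Matrix.det_transpose, Matrix.det_nonsing_inv,
    det_Theta, moyalConst]
  simp [mul_pow, mul_comm]

theorem integral_comp_momentumMap {F : Type*} [NormedAddCommGroup F] [NormedSpace ℝ F]
    (f : Space n → F) :
    moyalConst n θ • ∫ y, f (momentumMap n θ y) = ∫ y, f y := by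
  have h0 := moyalConst_pos n θ
  have h1 := Measure.map_linearMap_addHaar_eq_smul_addHaar (volume : Measure (Space n))
    (f := (momentumMap n θ : Space n →L[ℝ] Space n).toLinearMap)
    (by rw [det_momentumMap]; exact h0.ne')
  rw [det_momentumMap] at h1
  have h2 : ∫ y, f (momentumMap n θ y) =
      ∫ y, f y ∂(Measure.map (momentumMap n θ) (volume : Measure (Space n))) :=
    ((momentumMap n θ).toHomeomorph.measurableEmbedding.integral_map f).symm
  have h3 : Measure.map (momentumMap n θ) (volume : Measure (Space n)) =
    ENNReal.ofReal |(moyalConst n θ)⁻¹| • volume := h1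
  rw [h2, h3, integral_smul_measure, ENNReal.toReal_ofReal (abs_nonneg _),
    abs_of_pos (inv_pos.2 h0), smul_smul, mul_inv_cancel₀ h0.ne', one_smul]

end Form

/-! ### Phases -/

/-- The phase `e^{i t}`. -/
def phase (t : ℝ) : ℂ := Complex.exp (t * Complex.I)

theorem phase_add (s t : ℝ) : phase (s + t) = phase s * phase t := by
  rw [phase, phase, phase, ← Complex.exp_add]
  push_cast
  ring_nf

@[simp]
theorem phase_zero : phase 0 = 1 := by simp [phase]

@[simp]
theorem norm_phase (t : ℝ) : ‖phase t‖ = 1 := Complex.norm_exp_ofReal_mul_I t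

theorem conj_phase (t : ℝ) : conj (phase t) = phase (-t) := by
  simp [phase, ← Complex.exp_conj]

@[fun_prop]
theorem continuous_phase {X : Type*} [TopologicalSpace X] {f : X → ℝ} (hf : Continuous f) :
    Continuous fun x => phase (f x) := by
  unfold phase
  fun_prop

/-! ### The symplectic Fourier transform -/

section Fourier

variable (n : ℕ) (θ : ℝ) [NeZero θ]

/-- The symplectic Fourier transform `b ↦ ∫ e^{-2 i y Θ⁻¹ z} b(z) dz`. -/
def symplFourier : 𝓢(Space n, ℂ) →L[ℂ] 𝓢(Space n, ℂ) :=
  (SchwartzMap.compCLMOfContinuousLinearEquiv ℂ (momentumMap n θ)).comp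
    (FourierTransform.fourierCLM ℂ 𝓢(Space n, ℂ))

theorem symplFourier_apply' (b : 𝓢(Space n, ℂ)) (y : Space n) :
    symplFourier n θ b y = 𝓕 (b : Space n → ℂ) (momentumMap n θ y) := rfl

theorem symplFourier_apply (b : 𝓢(Space n, ℂ)) (y : Space n) :
    symplFourier n θ b y = ∫ z, phase (-2 * thetaInvForm n θ y z) * b z := by
  rw [symplFourier_apply', Real.fourier_eq']
  refine integral_congr_ae (.of_forall fun z => ?_)
  simp only [smul_eq_mul, phase]
  rw [thetaInvForm_eq_inner, real_inner_comm]
  congr 4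
  ring

/-- Ordinary Fourier inversion after the substitution `ξ = M y`, with `M` the momentum map; its
Jacobian is the constant in front. -/
theorem symplFourier_inversion (b : 𝓢(Space n, ℂ)) (x : Space n) :
    moyalConst n θ • ∫ y, phase (2 * thetaInvForm n θ y x) * symplFourier n θ b y = b x := by
  have h := integral_comp_momentumMap n θ
    (fun ξ => Complex.exp ((2 * Real.pi * inner ℝ ξ x : ℝ) * Complex.I) • 𝓕 (b : Space n → ℂ) ξ)
  have h2 : 𝓕⁻ (𝓕 (b : Space n → ℂ)) x = b x := by
    have := FourierTransform.fourierInv_fourier_eq (F := 𝓢(Space n, ℂ)) b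
    have h3 := congrArg (fun f : 𝓢(Space n, ℂ) => f x) this
    simp only [SchwartzMap.fourierInv_coe, SchwartzMap.fourier_coe] at h3
    exact h3
  rw [← h2, Real.fourierInv_eq', ← h]
  congr 1
  refine integral_congr_ae (.of_forall fun y => ?_)
  simp only [smul_eq_mul, phase, symplFourier_apply']
  rw [thetaInvForm_eq_inner]
  congr 4
  ring

theorem moyalStar_apply_double (a b : 𝓢(Space n, ℂ)) (x : Space n) :
    moyalStar n θ a b x = moyalConst n θ *
      ∫ y, ∫ z, a (x + y) * b (x + z) * phase (-2 * thetaInvForm n θ y z) := by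
  change moyalIntegral n θ a b x = _
  rw [moyalIntegral, moyalConst]
  congr 1
  · push_cast
    simp
  · refine integral_congr_ae (.of_forall fun y => integral_congr_ae (.of_forall fun z => ?_))
    simp only [phase]
    congr 2
    push_cast
    ring

/-- Translating `z` by `x` turns the inner integral into a phase times the transform of `b`. This
leaves an absolutely convergent single integral, the form used for Fubini arguments. -/
theorem moyalStar_apply (a b : 𝓢(Space n, ℂ)) (x : Space n) :
    moyalStar n θ a b x = moyalConst n θ *
      ∫ y, phase (2 * thetaInvForm n θ y x) * a (x + y) * symplFourier n θ b y := by
  rw [moyalStar_apply_double]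
  congr 1
  refine integral_congr_ae (.of_forall fun y => ?_)
  simp only [mul_assoc]
  rw [integral_const_mul, symplFourier_apply, mul_left_comm]
  congr 1
  rw [← integral_add_left_eq_self (fun z => phase (-2 * thetaInvForm n θ y z) * b z) x,
    ← integral_const_mul]
  refine integral_congr_ae (.of_forall fun z => ?_)
  simp only [thetaInvForm_add_right, mul_add, phase_add]
  have : phase (2 * thetaInvForm n θ y x) * phase (-2 * thetaInvForm n θ y x) = 1 := by
    rw [← phase_add]; simp
  linear_combination (-b (x + z) * phase (-2 * thetaInvForm n θ y z)) * this

end Fourier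

/-! ### The Moyal product of Schwartz functions -/

section StarAlgebra

variable {n : ℕ} (θ : ℝ) [NeZero θ]

theorem integrable_phase_mul {X : Type*} [TopologicalSpace X] [MeasurableSpace X]
    [OpensMeasurableSpace X] {μ : Measure X} {φ : X → ℝ}
    {f : X → ℂ} (hφ : Continuous φ) (hf : Integrable f μ) :
    Integrable (fun x => phase (φ x) * f x) μ :=
  hf.bdd_mul (c := 1) (continuous_phase hφ).aestronglyMeasurable (.of_forall fun x => by simp)

theorem integrable_shift_mul (a b : 𝓢(Space n, ℂ)) :
    Integrable (fun p : Space n × Space n => a (p.1 + p.2) * b p.2) (volume.prod volume) :=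
  ((measurePreserving_add_prod volume volume).integrable_comp_of_integrable
    (a.integrable.mul_prod b.integrable) :)

theorem integrable_shift_sub_mul (a b : 𝓢(Space n, ℂ)) :
    Integrable (fun p : Space n × Space n => b p.1 * a (p.2 - p.1)) (volume.prod volume) :=
  ((measurePreserving_prod_sub volume volume).integrable_comp_of_integrable
    (b.integrable.mul_prod a.integrable) :)

/-- The transform carries the star product to a twisted convolution: integrate over `x` first and
substitute `x + y`, the cross phase `yΘ⁻¹y` being zero. -/
theorem symplFourier_moyalStar (b c : 𝓢(Space n, ℂ)) (u : Space n) :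
    symplFourier n θ (moyalStar n θ b c) u = moyalConst n θ *
      ∫ y, phase (2 * thetaInvForm n θ u y) * symplFourier n θ b (u - y) *
        symplFourier n θ c y := by
  have hI : Integrable (Function.uncurry fun x y : Space n =>
      phase (-2 * thetaInvForm n θ u x + 2 * thetaInvForm n θ y x) *
        (b (x + y) * symplFourier n θ c y)) (volume.prod volume) :=
    integrable_phase_mul (by fun_prop) (integrable_shift_mul b (symplFourier n θ c))
  calc symplFourier n θ (moyalStar n θ b c) u
      = moyalConst n θ * ∫ x, ∫ y, phase (-2 * thetaInvForm n θ u x + 2 * thetaInvForm n θ y x) *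
        (b (x + y) * symplFourier n θ c y) := by
        rw [symplFourier_apply, ← integral_const_mul]
        refine integral_congr_ae (.of_forall fun x => ?_)
        simp only
        rw [moyalStar_apply, mul_left_comm, ← integral_const_mul]
        congr 2
        funext y
        rw [phase_add]
        ring
    _ = _ := by
        rw [integral_integral_swap hI]
        congr 2
        funext y
        rw [symplFourier_apply n θ b, mul_assoc, ← integral_mul_const, ← integral_const_mul,
          ← integral_add_right_eq_self (μ := (volume : Measure (Space n))) (fun z =>
            phase (2 * thetaInvForm n θ u y) * (phase (-2 * thetaInvForm n θ (u - y) z) * b z *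
              symplFourier n θ c y)) y]
        congr 1
        funext x
        have h : phase (-2 * thetaInvForm n θ u x + 2 * thetaInvForm n θ y x) =
            phase (2 * thetaInvForm n θ u y) * phase (-2 * thetaInvForm n θ (u - y) (x + y)) := by
          rw [← phase_add, thetaInvForm_sub_left, thetaInvForm_add_right, thetaInvForm_add_right,
            thetaInvForm_self]
          congr 1
          ring
        rw [h]
        ring

/-- Both sides are `c₀² ∬ e^{2i(uΘ⁻¹x + uΘ⁻¹y)} a(x+u) b̂(u-y) ĉ(y)`, with `c₀ = (πθ)^{-D}`: on the
left after the shift `u ↦ u - y`, on the right by the twisted convolution formula. -/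
theorem moyalStar_assoc (a b c : 𝓢(Space n, ℂ)) :
    moyalStar n θ (moyalStar n θ a b) c = moyalStar n θ a (moyalStar n θ b c) := by
  ext x
  have hI : Integrable (Function.uncurry fun y u : Space n =>
      phase (2 * thetaInvForm n θ u x + 2 * thetaInvForm n θ u y) * (a (x + u) *
        (symplFourier n θ c y * symplFourier n θ b (u - y)))) (volume.prod volume) := by
    refine integrable_phase_mul (by fun_prop) (Integrable.bdd_mul
      (c := SchwartzMap.seminorm ℝ 0 0 a)
      (integrable_shift_sub_mul (symplFourier n θ b) (symplFourier n θ c)) ?_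
      (.of_forall fun p => a.norm_le_seminorm ℝ _))
    exact (a.continuous.comp (continuous_const.add continuous_snd)).aestronglyMeasurable
  rw [moyalStar_apply, moyalStar_apply]
  congr 1
  calc _ = ∫ y, ∫ u, moyalConst n θ * (phase (2 * thetaInvForm n θ u x +
        2 * thetaInvForm n θ u y) * (a (x + u) *
        (symplFourier n θ c y * symplFourier n θ b (u - y)))) := by
        congr 1
        funext y
        rw [moyalStar_apply, integral_const_mul, mul_left_comm, mul_assoc, mul_right_comm,
          mul_assoc, mul_comm (symplFourier n θ c y), ← integral_mul_const,
          ← integral_const_mul, ← integral_sub_right_eq_self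
            (μ := (volume : Measure (Space n))) _ y]
        congr 2
        funext u
        have h : phase (2 * thetaInvForm n θ u x + 2 * thetaInvForm n θ u y) =
            phase (2 * thetaInvForm n θ y x) * phase (2 * thetaInvForm n θ (u - y) (x + y)) := by
          rw [← phase_add, thetaInvForm_sub_left, thetaInvForm_add_right, thetaInvForm_add_right,
            thetaInvForm_self]
          congr 1
          ring
        rw [h, show x + y + (u - y) = x + u by abel]
        ring
    _ = _ := by
        simp_rw [integral_const_mul (moyalConst n θ : ℂ)]
        rw [integral_integral_swap hI, ← integral_const_mul]
        congr 1
        funext u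
        rw [symplFourier_moyalStar, mul_left_comm, ← integral_const_mul (_ * a (x + u))]
        congr 2
        funext y
        rw [phase_add]
        ring

/-- After Fubini, translating `x` by `y` leaves the phase unchanged, since `yΘ⁻¹y = 0`; the
remaining `y`-integral is the inversion formula for `b`. -/
theorem integral_moyalStar (a b : 𝓢(Space n, ℂ)) :
    ∫ x, moyalStar n θ a b x = ∫ x, a x * b x := by
  have h1 : Integrable (Function.uncurry fun x y : Space n =>
      phase (2 * thetaInvForm n θ y x) * (a (x + y) * symplFourier n θ b y))
      (volume.prod volume) :=
    integrable_phase_mul (by fun_prop) (integrable_shift_mul a (symplFourier n θ b))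
  have h2 : Integrable (Function.uncurry fun x y : Space n =>
      phase (2 * thetaInvForm n θ y x) * (a x * symplFourier n θ b y))
      (volume.prod volume) :=
    integrable_phase_mul (by fun_prop) (a.integrable.mul_prod (symplFourier n θ b).integrable)
  calc ∫ x, moyalStar n θ a b x
      = moyalConst n θ * ∫ x, ∫ y, phase (2 * thetaInvForm n θ y x) *
          (a (x + y) * symplFourier n θ b y) := by
        simp only [moyalStar_apply, integral_const_mul, mul_assoc]
    _ = moyalConst n θ * ∫ y, ∫ x, phase (2 * thetaInvForm n θ y x) *
          (a x * symplFourier n θ b y) := by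
        rw [integral_integral_swap h1]
        congr 2
        funext y
        rw [← integral_add_right_eq_self (μ := (volume : Measure (Space n))) (fun x =>
          phase (2 * thetaInvForm n θ y x) * (a x * symplFourier n θ b y)) y]
        simp only [thetaInvForm_add_right, thetaInvForm_self, add_zero]
    _ = _ := by
        rw [← integral_integral_swap h2, ← integral_const_mul]
        congr 1
        funext x
        rw [← symplFourier_inversion n θ b x, Complex.real_smul, mul_left_comm,
          ← integral_const_mul (a x)]
        congr 2
        funext y
        ring

theorem conj_integral_eq {X : Type*} [MeasurableSpace X] (μ : Measure X) (f : X → ℂ) :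
    conj (∫ x, f x ∂μ) = ∫ x, conj (f x) ∂μ := integral_conj.symm

theorem schwartzConj_apply (a : 𝓢(Space n, ℂ)) (x : Space n) :
    schwartzConj a x = conj (a x) := rfl

@[simp]
theorem schwartzConj_schwartzConj (a : 𝓢(Space n, ℂ)) : schwartzConj (schwartzConj a) = a := by
  ext x
  simp [schwartzConj_apply]

/-- Conjugation flips the sign of the phase, and antisymmetry of the form turns this sign into the
exchange of `y` and `z`, that is, of the two factors. -/
theorem schwartzConj_moyalStar (a b : 𝓢(Space n, ℂ)) :
    schwartzConj (moyalStar n θ a b) = moyalStar n θ (schwartzConj b) (schwartzConj a) := by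
  ext x
  have hI : Integrable (Function.uncurry fun y z : Space n =>
      conj (a (x + y)) * conj (b (x + z)) * phase (2 * thetaInvForm n θ y z))
      (volume.prod volume) := by
    have h1 := ((schwartzConj a).integrable (μ := volume)).comp_add_left x
    have h2 := ((schwartzConj b).integrable (μ := volume)).comp_add_left x
    have h3 := integrable_phase_mul (φ := fun p : Space n × Space n =>
      2 * thetaInvForm n θ p.1 p.2) (by fun_prop) (h1.mul_prod h2)
    refine h3.congr (.of_forall fun p => ?_)
    simp only [Function.uncurry, schwartzConj_apply]
    ring
  rw [schwartzConj_apply, moyalStar_apply_double, moyalStar_apply_double, map_mul,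
    Complex.conj_ofReal]
  congr 1
  simp only [conj_integral_eq, map_mul, conj_phase, schwartzConj_apply, neg_mul, neg_neg]
  rw [integral_integral_swap hI]
  congr 1
  funext z
  congr 1
  funext y
  rw [thetaInvForm_swap n θ z y]
  ring_nf

/-- Translation `a ↦ a (· + h)` of Schwartz functions. -/
def translate (h : Space n) : 𝓢(Space n, ℂ) →L[ℂ] 𝓢(Space n, ℂ) :=
  SchwartzMap.compSubConstCLM ℂ (-h)

@[simp]
theorem translate_apply (h : Space n) (a : 𝓢(Space n, ℂ)) (x : Space n) :
    translate h a x = a (x + h) := by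
  simp [translate]

theorem hasDerivAt_phase (t : ℝ) : HasDerivAt phase (Complex.I * phase t) t := by
  have h : HasDerivAt (fun t : ℝ => (t : ℂ) * Complex.I) (1 * Complex.I) t :=
    (Complex.ofRealCLM.hasDerivAt (x := t)).mul_const _
  have h2 := h.cexp
  rw [one_mul, mul_comm] at h2
  exact h2

theorem iteratedDeriv_phase (m : ℕ) :
    iteratedDeriv m phase = fun t => Complex.I ^ m * phase t := by
  induction m with
  | zero => simp [iteratedDeriv_zero]
  | succ m ih =>
    rw [iteratedDeriv_succ, ih]
    funext t
    rw [((hasDerivAt_phase t).const_mul (Complex.I ^ m)).deriv]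
    ring

/-- Every derivative has modulus one. This makes modulation an operator on `𝓢`. -/
theorem phase_hasTemperateGrowth : Function.HasTemperateGrowth phase := by
  refine ⟨((Complex.ofRealCLM.contDiff).mul contDiff_const).cexp, fun m => ⟨0, 1, fun t => ?_⟩⟩
  rw [norm_iteratedFDeriv_eq_norm_iteratedDeriv, iteratedDeriv_phase]
  simp

theorem phase_thetaInvForm_hasTemperateGrowth (h : Space n) :
    Function.HasTemperateGrowth fun x => phase (2 * thetaInvForm n θ h x) := by
  refine phase_hasTemperateGrowth.comp (g := phase) ?_
  have : (fun x => 2 * thetaInvForm n θ h x) =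
      ((2 * Real.pi) • innerSL ℝ (momentumMap n θ h) : Space n →L[ℝ] ℝ) := by
    funext x
    simp [thetaInvForm_eq_inner, mul_assoc]
  rw [this]
  exact ContinuousLinearMap.hasTemperateGrowth _

/-- Multiplication of Schwartz functions by `x ↦ e^{2 i h Θ⁻¹ x}`. -/
def modulate (h : Space n) : 𝓢(Space n, ℂ) →L[ℂ] 𝓢(Space n, ℂ) :=
  SchwartzMap.smulLeftCLM ℂ fun x => phase (2 * thetaInvForm n θ h x)

@[simp]
theorem modulate_apply (h : Space n) (a : 𝓢(Space n, ℂ)) (x : Space n) :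
    modulate θ h a x = phase (2 * thetaInvForm n θ h x) * a x := by
  rw [modulate, SchwartzMap.smulLeftCLM_apply_apply (phase_thetaInvForm_hasTemperateGrowth θ h),
    smul_eq_mul]

/-- This is `(a ⋆ u) ⋆ b = a ⋆ (u ⋆ b)` for the plane wave `u = e^{2i hΘ⁻¹x}`, with both products by
`u` written out so that only Schwartz functions occur. -/
theorem modulate_translate_moyalStar (h : Space n) (a b : 𝓢(Space n, ℂ)) :
    moyalStar n θ (modulate θ h (translate h a)) b =
      moyalStar n θ a (modulate θ h (translate (-h) b)) := by
  ext x
  rw [moyalStar_apply_double, moyalStar_apply_double]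
  congr 1
  -- The net substitutions are `y ↦ y - h` on the left and `z ↦ z + h` on the right; the two shifts
  -- of `z` on the left cancel. Both integrands then contain `a(x+y) b(x+z)` and only phases remain
  -- to be compared.
  rw [← integral_sub_right_eq_self (μ := (volume : Measure (Space n))) _ h]
  congr 1
  funext y
  rw [← integral_sub_right_eq_self (μ := (volume : Measure (Space n)))
    (fun z => modulate θ h (translate h a) (x + (y - h)) * _ * _) h]
  rw [← integral_add_right_eq_self (μ := (volume : Measure (Space n)))
    (fun z => modulate θ h (translate h a) (x + (y - h)) * b (x + (z - h)) *
      phase (-2 * thetaInvForm n θ (y - h) (z - h))) h]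
  rw [← integral_add_right_eq_self (μ := (volume : Measure (Space n)))
    (fun z => a (x + y) * _ * _) h]
  congr 1
  funext z
  simp only [modulate_apply, translate_apply, add_sub_cancel_right,
    show x + (y - h) + h = x + y by abel, show x + (z + h) + -h = x + z by abel]
  have : phase (2 * thetaInvForm n θ h (x + (y - h))) * phase (-2 * thetaInvForm n θ (y - h) z) =
      phase (2 * thetaInvForm n θ h (x + (z + h))) * phase (-2 * thetaInvForm n θ y (z + h)) := by
    rw [← phase_add, ← phase_add]
    simp only [thetaInvForm_add_right, thetaInvForm_sub_left, thetaInvForm_sub_right,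
      thetaInvForm_self]
    rw [thetaInvForm_swap n θ h y]
    congr 1
    ring
  linear_combination (a (x + y) * b (x + z)) * this

end StarAlgebra

/-! ### The Schwartz space is barrelled -/

section Complete

variable {E F : Type*} [NormedAddCommGroup E] [NormedSpace ℝ E] [NormedAddCommGroup F]
  [NormedSpace ℝ F]

theorem exists_seminorm_sub_lt {u : ℕ → 𝓢(E, F)} (hu : CauchySeq u) (k m : ℕ) {ε : ℝ}
    (hε : 0 < ε) : ∃ N, ∀ i ≥ N, ∀ j ≥ N, SchwartzMap.seminorm ℝ k m (u i - u j) < ε := by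
  have h1 : Filter.Tendsto (fun p : ℕ × ℕ => u p.2 - u p.1) Filter.atTop (nhds 0) := by
    have h2 := cauchySeq_iff_tendsto.1 hu
    rw [uniformity_eq_comap_nhds_zero 𝓢(E, F), Filter.tendsto_comap_iff] at h2
    exact h2
  have h2 : Continuous (SchwartzMap.seminorm ℝ k m : Seminorm ℝ 𝓢(E, F)) :=
    (schwartz_withSeminorms ℝ E F).continuous_seminorm (k, m)
  have h3 := (h2.tendsto 0).comp h1
  rw [map_zero] at h3
  obtain ⟨⟨a, b⟩, hab⟩ := Filter.eventually_atTop.1 (h3.eventually (gt_mem_nhds hε))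
  exact ⟨max a b, fun i hi j hj =>
    hab (j, i) ⟨(le_max_left a b).trans hj, (le_max_right a b).trans hi⟩⟩

theorem norm_pow_mul_iteratedFDeriv_sub_le (f g : 𝓢(E, F)) (k m : ℕ) (x : E) :
    ‖x‖ ^ k * ‖iteratedFDeriv ℝ m f x - iteratedFDeriv ℝ m g x‖ ≤
      SchwartzMap.seminorm ℝ k m (f - g) := by
  have h := (f - g).le_seminorm ℝ k m x
  rwa [show ((f - g : 𝓢(E, F)) : E → F) = (f : E → F) - g from rfl,
    iteratedFDeriv_sub_apply (f.smooth m).contDiffAt (g.smooth m).contDiffAt] at h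

/-- Completeness serves only to make `𝓢` a Baire space, so that Banach–Steinhaus applies to
functionals on it. A Cauchy sequence converges uniformly, with every polynomial weight, in all
derivatives. -/
instance schwartzMapCompleteSpace [CompleteSpace F] : CompleteSpace 𝓢(E, F) := by
  have : (uniformity 𝓢(E, F)).IsCountablyGenerated :=
    IsUniformAddGroup.uniformity_countably_generated
  refine UniformSpace.complete_of_cauchySeq_tendsto fun u hu => ?_
  have hlim : ∀ m x, ∃ y, Filter.Tendsto (fun i => iteratedFDeriv ℝ m (u i) x) Filter.atTop
      (nhds y) := fun m x => by
    refine cauchySeq_tendsto_of_complete (Metric.cauchySeq_iff.2 fun ε hε => ?_)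
    obtain ⟨N, hN⟩ := exists_seminorm_sub_lt hu 0 m hε
    refine ⟨N, fun i hi j hj => ?_⟩
    rw [dist_eq_norm]
    have := norm_pow_mul_iteratedFDeriv_sub_le (u i) (u j) 0 m x
    rw [pow_zero, one_mul] at this
    exact this.trans_lt (hN i hi j hj)
  choose g hg using hlim
  -- Letting `j → ∞` in the Cauchy estimate gives weighted convergence, uniform in `x`.
  have hbound : ∀ (k m : ℕ) {ε : ℝ}, 0 < ε → ∃ N, ∀ i ≥ N, ∀ x,
      ‖x‖ ^ k * ‖iteratedFDeriv ℝ m (u i) x - g m x‖ ≤ ε := fun k m ε hε => by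
    obtain ⟨N, hN⟩ := exists_seminorm_sub_lt hu k m hε
    refine ⟨N, fun i hi x => ?_⟩
    have h1 := (Filter.Tendsto.const_sub (iteratedFDeriv ℝ m (u i) x) (hg m x)).norm
    refine le_of_tendsto (h1.const_mul (‖x‖ ^ k)) (Filter.eventually_atTop.2 ⟨N, fun j hj => ?_⟩)
    exact (norm_pow_mul_iteratedFDeriv_sub_le (u i) (u j) k m x).trans
      (hN i hi j hj).le
  -- The unweighted case `k = 0` gives uniform convergence of the next derivatives, so the limits `g
  -- m` form a Taylor series.
  have hderiv : ∀ m x, HasFDerivAt (g m) (g (m + 1) x).curryLeft x := fun m => by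
    refine hasFDerivAt_of_tendstoUniformly (l := Filter.atTop)
      (f := fun i => iteratedFDeriv ℝ m (u i))
      (f' := fun i x => (iteratedFDeriv ℝ (m + 1) (u i) x).curryLeft)
      (g' := fun x => (g (m + 1) x).curryLeft) ?_ (fun i x => ?_) (hg m)
    · refine Metric.tendstoUniformly_iff.2 fun ε hε => ?_
      obtain ⟨N, hN⟩ := hbound 0 (m + 1) (half_pos hε)
      refine Filter.eventually_atTop.2 ⟨N, fun i hi x => ?_⟩
      have h := hN i hi x
      rw [pow_zero, one_mul] at h
      have h2 : (g (m + 1) x).curryLeft - (iteratedFDeriv ℝ (m + 1) (u i) x).curryLeft =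
        (g (m + 1) x - iteratedFDeriv ℝ (m + 1) (u i) x).curryLeft := rfl
      rw [dist_eq_norm, h2, ContinuousMultilinearMap.curryLeft_norm, norm_sub_rev]
      linarith
    · have h := ((u i).smooth ⊤).ftaylorSeries.fderiv m (by exact_mod_cast ENat.natCast_lt_top m) x
      exact h
  set f : E → F := fun x => (g 0 x).curry0 with hf
  have hT : HasFTaylorSeriesUpTo ∞ f fun x m => g m x :=
    ⟨fun x => rfl, fun m _ x => hderiv m x, fun m _ =>
      continuous_iff_continuousAt.2 fun x => (hderiv m x).continuousAt⟩
  have hD : ∀ m x, iteratedFDeriv ℝ m f x = g m x := fun m x =>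
    (hT.eq_iteratedFDeriv (by exact_mod_cast le_top) x).symm
  have hsmooth : ContDiff ℝ ∞ f := hT.contDiff
  refine ⟨⟨f, hsmooth, fun k m => ?_⟩, ?_⟩
  · obtain ⟨N, hN⟩ := hbound k m one_pos
    refine ⟨SchwartzMap.seminorm ℝ k m (u N) + 1, fun x => ?_⟩
    rw [hD]
    calc ‖x‖ ^ k * ‖g m x‖ ≤ ‖x‖ ^ k * (‖iteratedFDeriv ℝ m (u N) x‖ +
          ‖iteratedFDeriv ℝ m (u N) x - g m x‖) := by
          gcongr
          have := norm_sub_le (iteratedFDeriv ℝ m (u N) x) (iteratedFDeriv ℝ m (u N) x - g m x)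
          rwa [sub_sub_cancel] at this
      _ ≤ _ := by
          rw [mul_add]
          exact add_le_add ((u N).le_seminorm ℝ k m x) (hN N le_rfl x)
  · refine ((schwartz_withSeminorms ℝ E F).tendsto_nhds_atTop _ _).2 fun ⟨k, m⟩ ε hε => ?_
    obtain ⟨N, hN⟩ := hbound k m (half_pos hε)
    refine ⟨N, fun i hi => (SchwartzMap.seminorm_le_bound ℝ k m _ (half_pos hε).le
      fun x => ?_).trans_lt (half_lt_self hε)⟩
    have h := hN i hi x
    rw [← hD] at h
    rw [← iteratedFDeriv_sub_apply ((u i).smooth m).contDiffAt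
      (hsmooth.of_le (by exact_mod_cast le_top)).contDiffAt] at h
    exact h

instance schwartzMapBaireSpace [CompleteSpace F] : BaireSpace 𝓢(E, F) := by
  have : (uniformity 𝓢(E, F)).IsCountablyGenerated :=
    IsUniformAddGroup.uniformity_countably_generated
  infer_instance

end Complete

/-! ### Quantitative estimates for oscillatory integrals -/

theorem norm_pow_le_one_add_mul {E : Type*} [SeminormedAddCommGroup E] (k : ℕ) (x y z : E)
    (h : ‖x‖ ≤ ‖z‖ + ‖y‖) :
    ‖x‖ ^ k ≤ (1 + ‖y‖) ^ k * (1 + ‖z‖) ^ k := by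
  rw [← mul_pow]
  gcongr
  nlinarith [norm_nonneg y, norm_nonneg z]

theorem exists_one_add_norm_pow_mul_le {E F : Type*} [NormedAddCommGroup E]
    [NormedSpace ℝ E] [NormedAddCommGroup F] [NormedSpace ℝ F]
    (a : 𝓢(E, F)) (k : ℕ) : ∃ C, 0 ≤ C ∧ ∀ x, (1 + ‖x‖) ^ k * ‖a x‖ ≤ C := by
  have h := fun x => SchwartzMap.one_add_le_sup_seminorm_apply (𝕜 := ℝ) (m := (k, 0))
    (le_refl k) (le_refl 0) a x
  simp only [norm_iteratedFDeriv_zero] at h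
  exact ⟨_, le_trans (by positivity) (h 0), h⟩

/-- Mean value inequality on the segment from `x` to `x + y`, with the weight frozen at `x`; each
`z` on the segment satisfies `‖x‖ ≤ ‖z‖ + ‖y‖`, so the decay of the derivative at `z` absorbs the
weight. -/
theorem exists_norm_sub_le {E F : Type*} [NormedAddCommGroup E] [NormedSpace ℝ E]
    [NormedAddCommGroup F] [NormedSpace ℝ F]
    (a : 𝓢(E, F)) (k : ℕ) : ∃ C, 0 ≤ C ∧ ∀ x y, ‖x‖ ^ k * ‖a (x + y) - a x‖ ≤
      C * (‖y‖ * (1 + ‖y‖) ^ k) := by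
  obtain ⟨C, hC0, hC⟩ := exists_one_add_norm_pow_mul_le (SchwartzMap.fderivCLM ℝ E F a) k
  refine ⟨C, hC0, fun x y => ?_⟩
  have h := Convex.norm_image_sub_le_of_norm_hasFDerivWithin_le (𝕜 := ℝ)
    (f := fun z => (‖x‖ ^ k : ℝ) • a z) (C := C * (1 + ‖y‖) ^ k) (s := segment ℝ x (x + y))
    (f' := fun z => (‖x‖ ^ k : ℝ) • SchwartzMap.fderivCLM ℝ E F a z) (x := x) (y := x + y)
    (fun z _ => ((a.differentiableAt (x := z)).hasFDerivAt.const_smul _).hasFDerivWithinAt)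
    (fun z hz => ?_) (convex_segment _ _) (left_mem_segment ℝ _ _) (right_mem_segment ℝ _ _)
  · simp only [← smul_sub, norm_smul, norm_pow, norm_norm, add_sub_cancel_left] at h
    refine h.trans_eq (by ring)
  · rw [norm_smul, norm_pow, norm_norm]
    have hz2 : ‖x‖ ≤ ‖z‖ + ‖y‖ := by
      rw [segment_eq_image'] at hz
      obtain ⟨t, ht, rfl⟩ := hz
      have h1 : ‖t • (x + y - x)‖ ≤ ‖y‖ := by
        rw [add_sub_cancel_left, norm_smul, Real.norm_of_nonneg ht.1]
        nlinarith [norm_nonneg y, ht.2]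
      have h2 := norm_sub_le (x + t • (x + y - x)) (t • (x + y - x))
      rw [add_sub_cancel_right] at h2
      linarith
    calc _ ≤ ((1 + ‖y‖) ^ k * (1 + ‖z‖) ^ k) * ‖SchwartzMap.fderivCLM ℝ E F a z‖ := by
          gcongr
          exact norm_pow_le_one_add_mul k x y z hz2
      _ = ((1 + ‖z‖) ^ k * ‖SchwartzMap.fderivCLM ℝ E F a z‖) * (1 + ‖y‖) ^ k := by ring
      _ ≤ _ := by
          gcongr
          exact hC z

section OscEstimates

variable {E : Type} [NormedAddCommGroup E] [InnerProductSpace ℝ E] [FiniteDimensional ℝ E]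
  [MeasurableSpace E] [BorelSpace E]

/-- The absolute moment `∫ |y|^i (1 + |y|)^K |B(y)| dy`. -/
def absMoment {G : Type} [NormedAddCommGroup G] [NormedSpace ℝ G] (i K : ℕ) (B : 𝓢(E, G)) : ℝ :=
  ∫ y, ‖y‖ ^ i * (1 + ‖y‖) ^ K * ‖B y‖

theorem integrable_absMoment {G : Type} [NormedAddCommGroup G] [NormedSpace ℝ G] (i K : ℕ)
    (B : 𝓢(E, G)) : Integrable fun y => ‖y‖ ^ i * (1 + ‖y‖) ^ K * ‖B y‖ := by
  have h0 := B.integrable_pow_mul volume i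
  have h1 := B.integrable_pow_mul volume (i + K)
  refine ((h0.add h1).const_mul (2 ^ K)).mono' ?_ (.of_forall fun y => ?_)
  · have := B.continuous
    exact Continuous.aestronglyMeasurable (by fun_prop)
  · rw [Real.norm_of_nonneg (by positivity)]
    have h2 : (1 + ‖y‖) ^ K ≤ 2 ^ K * (1 + ‖y‖ ^ K) := by
      calc (1 + ‖y‖) ^ K ≤ 2 ^ (K - 1) * (1 ^ K + ‖y‖ ^ K) :=
            add_pow_le zero_le_one (norm_nonneg _) _
        _ ≤ _ := by
            rw [one_pow]
            gcongr
            · norm_num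
            · omega
    calc ‖y‖ ^ i * (1 + ‖y‖) ^ K * ‖B y‖ ≤ ‖y‖ ^ i * (2 ^ K * (1 + ‖y‖ ^ K)) * ‖B y‖ := by gcongr
      _ = _ := by
        simp only [Pi.add_apply]
        ring

theorem absMoment_mono {G : Type} [NormedAddCommGroup G] [NormedSpace ℝ G] (i : ℕ) {K L : ℕ}
    (h : K ≤ L) (B : 𝓢(E, G)) : absMoment i K B ≤ absMoment i L B := by
  refine integral_mono (integrable_absMoment i K B) (integrable_absMoment i L B) fun y => ?_
  have : 1 ≤ 1 + ‖y‖ := by linarith [norm_nonneg y]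
  simp only
  gcongr

theorem absMoment_one_le {G : Type} [NormedAddCommGroup G] [NormedSpace ℝ G] (K : ℕ)
    (B : 𝓢(E, G)) : absMoment 1 K B ≤ absMoment 0 (K + 1) B := by
  refine integral_mono (integrable_absMoment 1 K B) (integrable_absMoment 0 (K + 1) B) fun y => ?_
  have : ‖y‖ ≤ 1 + ‖y‖ := by linarith
  simp only [pow_one, pow_zero, one_mul]
  rw [pow_succ']
  gcongr

theorem absMoment_nonneg {G : Type} [NormedAddCommGroup G] [NormedSpace ℝ G] (i K : ℕ)
    (B : 𝓢(E, G)) : 0 ≤ absMoment i K B :=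
  integral_nonneg fun y => by positivity

theorem absMoment_smulRight_le {G : Type} [NormedAddCommGroup G] [NormedSpace ℝ G]
    (N : E →L[ℝ] E) (K : ℕ) (B : 𝓢(E, G)) :
    absMoment 0 K (SchwartzMap.smulRightCLM ℝ G ((innerSL ℝ).comp N) B) ≤
      ‖N‖ * absMoment 1 K B := by
  rw [absMoment, absMoment, ← integral_const_mul]
  refine integral_mono (integrable_absMoment 0 K _) ((integrable_absMoment 1 K B).const_mul _)
    fun y => ?_
  have h : ‖SchwartzMap.smulRightCLM ℝ G ((innerSL ℝ).comp N) B y‖ ≤ ‖N‖ * ‖y‖ * ‖B y‖ := by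
    change ‖(innerSL ℝ (N y)).smulRight (B y)‖ ≤ _
    rw [ContinuousLinearMap.norm_smulRight_apply, innerSL_apply_norm]
    gcongr
    exact N.le_opNorm y
  simp only [pow_zero, one_mul, pow_one]
  calc _ ≤ (1 + ‖y‖) ^ K * (‖N‖ * ‖y‖ * ‖B y‖) := by gcongr
    _ = _ := by ring

/-- Here `B` enters through an absolute moment, a quantity that scales well under dilation, instead
of through Schwartz seminorms. Differentiation changes the value spaces, so the induction on `m`
runs over all of them at once. -/
theorem osc_norm_le (N : E →L[ℝ] E) (k m : ℕ) : ∀ {F G H : Type} [NormedAddCommGroup F]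
    [NormedSpace ℝ F] [NormedAddCommGroup G] [NormedSpace ℝ G]
    [NormedAddCommGroup H] [NormedSpace ℝ H] [NormedSpace ℂ H] [IsScalarTower ℝ ℂ H]
    (L : F →L[ℝ] G →L[ℝ] H) (a : 𝓢(E, F)), ∃ (C : ℝ) (K : ℕ), 0 ≤ C ∧ ∀ (B : 𝓢(E, G)) (x : E),
      ‖x‖ ^ k * ‖iteratedFDeriv ℝ m (osc N L a B) x‖ ≤ C * absMoment 0 K B := by
  induction m with
  | zero =>
    intro F G H _ _ _ _ _ _ _ _ L a
    obtain ⟨C, hC0, hC⟩ := exists_one_add_norm_pow_mul_le a k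
    refine ⟨‖L‖ * C, k, by positivity, fun B x => ?_⟩
    rw [norm_iteratedFDeriv_zero, absMoment, ← integral_const_mul]
    calc ‖x‖ ^ k * ‖osc N L a B x‖ = ‖(‖x‖ ^ k : ℝ) • osc N L a B x‖ := by
          rw [norm_smul]; simp
      _ ≤ _ := by
          unfold osc
          rw [← integral_smul]
          refine norm_integral_le_of_norm_le ((integrable_absMoment 0 k B).const_mul _)
            (.of_forall fun y => ?_)
          rw [norm_smul, norm_osc_integrand, norm_pow, norm_norm, pow_zero, one_mul]
          have h1 := norm_pow_le_one_add_mul k x y (x + y) (by simpa using norm_sub_le (x + y) y)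
          calc ‖x‖ ^ k * ‖L (a (x + y)) (B y)‖ ≤
                ((1 + ‖y‖) ^ k * (1 + ‖x + y‖) ^ k) * (‖L‖ * ‖a (x + y)‖ * ‖B y‖) := by
                gcongr
                exact L.le_opNorm₂ _ _
            _ = ‖L‖ * ((1 + ‖x + y‖) ^ k * ‖a (x + y)‖) * ((1 + ‖y‖) ^ k * ‖B y‖) := by ring
            _ ≤ _ := by
                gcongr
                exact hC _
  | succ m ih =>
    intro F G H _ _ _ _ _ _ _ _ L a
    obtain ⟨C1, K1, hC1, h1⟩ := ih (L.precompL E) (SchwartzMap.fderivCLM ℝ E F a)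
    obtain ⟨C2, K2, hC2, h2⟩ := ih ((Complex.I • L).precompR E) a
    set D := SchwartzMap.fderivCLM ℝ E F
    set S := SchwartzMap.smulRightCLM ℝ (E := E) G ((innerSL ℝ).comp N)
    -- Differentiating the phase puts a factor `N y` on `B`, which costs `‖N‖` and one power of `1 +
    -- ‖y‖`.
    refine ⟨C1 + C2 * ‖N‖, max K1 (K2 + 1), by positivity, fun B x => ?_⟩
    have hd : ∀ x, HasFDerivAt (osc N L a B) _ x := osc_hasFDerivAt N L a B
    rw [← norm_iteratedFDeriv_fderiv, funext fun x => (hd x).fderiv]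
    have hadd := iteratedFDeriv_add_apply (𝕜 := ℝ) (i := m) (x := x)
      (osc_contDiff N m (L.precompL E) (D a) B).contDiffAt
      (osc_contDiff N m ((Complex.I • L).precompR E) a (S B)).contDiffAt
    have hle : ‖x‖ ^ k * ‖iteratedFDeriv ℝ m (osc N (L.precompL E) (D a) B +
        osc N ((Complex.I • L).precompR E) a (S B)) x‖ ≤
        C1 * absMoment 0 K1 B + C2 * absMoment 0 K2 (S B) := by
      rw [hadd]
      calc _ ≤ ‖x‖ ^ k * (‖iteratedFDeriv ℝ m (osc N (L.precompL E) (D a) B) x‖ +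
            ‖iteratedFDeriv ℝ m (osc N ((Complex.I • L).precompR E) a (S B)) x‖) := by
            gcongr; exact norm_add_le _ _
        _ ≤ _ := by
            rw [mul_add]
            exact add_le_add (h1 _ _) (h2 _ _)
    refine hle.trans ?_
    rw [add_mul, mul_assoc]
    gcongr
    · exact absMoment_mono 0 (le_max_left _ _) B
    · refine (absMoment_smulRight_le N K2 B).trans ?_
      gcongr
      exact (absMoment_one_le K2 B).trans (absMoment_mono 0 (le_max_right _ _) B)

/-- Replacing the phase by `1` and `a(x+y)` by `a(x)` each costs a factor `‖y‖`, hence the first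
moment on the right. -/
theorem osc_sub_norm_le (N : E →L[ℝ] E) (k m : ℕ) : ∀ {F G H : Type} [NormedAddCommGroup F]
    [NormedSpace ℝ F] [NormedAddCommGroup G] [NormedSpace ℝ G] [CompleteSpace G]
    [NormedAddCommGroup H] [NormedSpace ℝ H] [NormedSpace ℂ H] [IsScalarTower ℝ ℂ H]
    [CompleteSpace H]
    (L : F →L[ℝ] G →L[ℝ] H) (a : 𝓢(E, F)), ∃ (C : ℝ) (K : ℕ), 0 ≤ C ∧ ∀ (B : 𝓢(E, G)) (x : E),
      ‖x‖ ^ k * ‖iteratedFDeriv ℝ m (osc N L a B - fun x => L (a x) (∫ y, B y)) x‖ ≤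
        C * absMoment 1 K B := by
  induction m with
  | zero =>
    intro F G H _ _ _ _ _ _ _ _ _ _ L a
    -- The bound `|e^{i⟨Ny,x⟩} - 1| ≤ ‖N‖ ‖y‖ ‖x‖` uses one extra power of `‖x‖`.
    obtain ⟨C1, hC10, hC1⟩ := exists_one_add_norm_pow_mul_le a (k + 1)
    obtain ⟨C2, hC20, hC2⟩ := exists_norm_sub_le a k
    refine ⟨‖L‖ * (‖N‖ * C1 + C2), k + 1, by positivity, fun B x => ?_⟩
    rw [norm_iteratedFDeriv_zero, absMoment, ← integral_const_mul]
    have hL : L (a x) (∫ y, B y) = ∫ y, L (a x) (B y) :=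
      ((L (a x)).integral_comp_comm B.integrable).symm
    have hsub : (osc N L a B - fun x => L (a x) (∫ y, B y)) x =
        ∫ y, ((Complex.exp (((inner ℝ (N y) x : ℝ) : ℂ) * Complex.I) - 1) • L (a (x + y)) (B y) +
          L (a (x + y) - a x) (B y)) := by
      simp only [Pi.sub_apply]
      rw [hL, osc, ← integral_sub (osc_integrable N L a B x)
        ((L (a x)).integrable_comp B.integrable)]
      congr 1
      funext y
      rw [sub_smul, one_smul, map_sub, sub_apply]
      abel
    calc _ = ‖(‖x‖ ^ k : ℝ) • (osc N L a B - fun x => L (a x) (∫ y, B y)) x‖ := by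
          rw [norm_smul]; simp
      _ ≤ _ := by
          rw [hsub, ← integral_smul]
          refine norm_integral_le_of_norm_le ((integrable_absMoment 1 (k + 1) B).const_mul _)
            (.of_forall fun y => ?_)
          rw [norm_smul, norm_pow, norm_norm, pow_one]
          have h1 := norm_pow_le_one_add_mul (k + 1) x y (x + y)
            (by simpa using norm_sub_le (x + y) y)
          have h2 : ‖Complex.exp (((inner ℝ (N y) x : ℝ) : ℂ) * Complex.I) - 1‖ ≤
              ‖N‖ * ‖y‖ * ‖x‖ := by
            rw [mul_comm]
            refine Real.norm_exp_I_mul_ofReal_sub_one_le.trans ((norm_inner_le_norm _ _).trans ?_)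
            gcongr
            exact N.le_opNorm y
          have h3 : (1 + ‖y‖) ^ k ≤ (1 + ‖y‖) ^ (k + 1) :=
            pow_le_pow_right₀ (by linarith [norm_nonneg y]) (Nat.le_succ k)
          have h4 : ‖x‖ ^ (k + 1) * ‖a (x + y)‖ ≤ (1 + ‖y‖) ^ (k + 1) * C1 := by
            calc _ ≤ ((1 + ‖y‖) ^ (k + 1) * (1 + ‖x + y‖) ^ (k + 1)) * ‖a (x + y)‖ := by gcongr
              _ ≤ _ := by
                rw [mul_assoc]
                gcongr
                exact hC1 _
          have h5 : ‖x‖ ^ k * ‖a (x + y) - a x‖ ≤ C2 * (‖y‖ * (1 + ‖y‖) ^ (k + 1)) :=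
            (hC2 x y).trans (by gcongr)
          calc _ ≤ ‖x‖ ^ k * ((‖N‖ * ‖y‖ * ‖x‖) * (‖L‖ * ‖a (x + y)‖ * ‖B y‖) +
                ‖L‖ * ‖a (x + y) - a x‖ * ‖B y‖) := by
                gcongr
                refine (norm_add_le _ _).trans (add_le_add ?_ (L.le_opNorm₂ _ _))
                rw [norm_smul]
                gcongr
                exact L.le_opNorm₂ _ _
            _ = ‖L‖ * (‖N‖ * ‖y‖ * (‖x‖ ^ (k + 1) * ‖a (x + y)‖) +
                ‖x‖ ^ k * ‖a (x + y) - a x‖) * ‖B y‖ := by ring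
            _ ≤ ‖L‖ * (‖N‖ * ‖y‖ * ((1 + ‖y‖) ^ (k + 1) * C1) +
                C2 * (‖y‖ * (1 + ‖y‖) ^ (k + 1))) * ‖B y‖ := by
                gcongr ‖L‖ * (‖N‖ * ‖y‖ * ?_ + ?_) * ‖B y‖
            _ = _ := by ring
  | succ m ih =>
    intro F G H _ _ _ _ _ _ _ _ _ _ L a
    obtain ⟨C1, K1, hC1, h1⟩ := ih (L.precompL E) (SchwartzMap.fderivCLM ℝ E F a)
    obtain ⟨C2, K2, hC2, h2⟩ := osc_norm_le N k m ((Complex.I • L).precompR E) a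
    set D := SchwartzMap.fderivCLM ℝ E F
    set S := SchwartzMap.smulRightCLM ℝ (E := E) G ((innerSL ℝ).comp N)
    refine ⟨C1 + C2 * ‖N‖, max K1 K2, by positivity, fun B x => ?_⟩
    -- Only the term that differentiates `a` needs its limit subtracted. The term that
    -- differentiates the phase already carries `N y`, so the cruder bound gives it a first moment.
    have hd : ∀ x, HasFDerivAt (osc N L a B - fun x => L (a x) (∫ y, B y))
        ((osc N (L.precompL E) (D a) B - fun x => L.precompL E (D a x) (∫ y, B y)) x +
          osc N ((Complex.I • L).precompR E) a (S B) x) x := fun x => by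
      have e1 := osc_hasFDerivAt N L a B x
      have e2 : HasFDerivAt (fun x => L (a x) (∫ y, B y))
          ((L.flip (∫ y, B y)).comp (D a x)) x :=
        (L.flip (∫ y, B y)).hasFDerivAt.comp x (a.differentiableAt (x := x)).hasFDerivAt
      convert e1.sub e2 using 1
      rw [Pi.sub_apply, sub_add_eq_add_sub]
      rfl
    rw [← norm_iteratedFDeriv_fderiv, funext fun x => (hd x).fderiv]
    have hc : ContDiff ℝ m (osc N (L.precompL E) (D a) B -
        fun x => L.precompL E (D a x) (∫ y, B y)) := by
      refine (osc_contDiff N m (L.precompL E) (D a) B).sub ?_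
      exact ((L.precompL E).flip (∫ y, B y)).contDiff.comp ((D a).smooth m)
    have hadd := iteratedFDeriv_add_apply (𝕜 := ℝ) (i := m) (x := x) hc.contDiffAt
      (osc_contDiff N m ((Complex.I • L).precompR E) a (S B)).contDiffAt
    have hle : ‖x‖ ^ k * ‖iteratedFDeriv ℝ m ((osc N (L.precompL E) (D a) B -
        fun x => L.precompL E (D a x) (∫ y, B y)) +
        osc N ((Complex.I • L).precompR E) a (S B)) x‖ ≤
        C1 * absMoment 1 K1 B + C2 * absMoment 0 K2 (S B) := by
      rw [hadd]
      calc _ ≤ ‖x‖ ^ k * (‖iteratedFDeriv ℝ m (osc N (L.precompL E) (D a) B -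
            fun x => L.precompL E (D a x) (∫ y, B y)) x‖ +
            ‖iteratedFDeriv ℝ m (osc N ((Complex.I • L).precompR E) a (S B)) x‖) := by
            gcongr; exact norm_add_le _ _
        _ ≤ _ := by
            rw [mul_add]
            exact add_le_add (h1 _ _) (h2 _ _)
    refine hle.trans ?_
    rw [add_mul, mul_assoc]
    gcongr
    · exact absMoment_mono 1 (le_max_left _ _) B
    · refine (absMoment_smulRight_le N K2 B).trans ?_
      gcongr
      exact absMoment_mono 1 (le_max_right _ _) B

end OscEstimates

/-! ### Approximate units -/

section ApproxUnit

variable {n : ℕ} (θ : ℝ) [NeZero θ]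

/-- The dilation `x ↦ a (R⁻¹ x)` of a Schwartz function. -/
def dilate (R : ℝˣ) : 𝓢(Space n, ℂ) →L[ℂ] 𝓢(Space n, ℂ) :=
  SchwartzMap.compCLMOfContinuousLinearEquiv ℂ (ContinuousLinearEquiv.smulLeft (R₁ := ℝ) R⁻¹)

theorem dilate_apply (R : ℝˣ) (a : 𝓢(Space n, ℂ)) (x : Space n) :
    dilate R a x = a ((R⁻¹ : ℝˣ) • x) := rfl

theorem symplFourier_dilate (R : ℝˣ) (a : 𝓢(Space n, ℂ)) (y : Space n) :
    symplFourier n θ (dilate R a) y =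
      |(R : ℝ) ^ Module.finrank ℝ (Space n)| • symplFourier n θ a ((R : ℝ) • y) := by
  rw [symplFourier_apply, symplFourier_apply]
  have h := Measure.integral_comp_smul (volume : Measure (Space n))
    (fun z => phase (-2 * thetaInvForm n θ ((R : ℝ) • y) z) * a z) ((R⁻¹ : ℝˣ) : ℝ)
  have h2 : |(R : ℝ) ^ Module.finrank ℝ (Space n)| =
      |((((R⁻¹ : ℝˣ) : ℝ)) ^ Module.finrank ℝ (Space n))⁻¹| := by
    rw [Units.val_inv_eq_inv_val, inv_pow, inv_inv]
  rw [h2, ← h]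
  refine integral_congr_ae (.of_forall fun z => ?_)
  simp only [dilate_apply, thetaInvForm_smul_left, thetaInvForm_smul_right]
  rw [← mul_assoc ((R⁻¹ : ℝˣ) : ℝ), Units.inv_mul, one_mul]
  rfl

/-- Dilation by `R` concentrates the transform at scale `R⁻¹` without changing its `L¹` norm: the
factor `‖y‖` yields `R⁻¹`, and `1 + ‖y‖/R ≤ 1 + ‖y‖`. -/
theorem absMoment_symplFourier_dilate_le (R : ℝˣ) (hR : 1 ≤ (R : ℝ)) (K : ℕ)
    (a : 𝓢(Space n, ℂ)) : absMoment 1 K (symplFourier n θ (dilate R a)) ≤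
      (R : ℝ)⁻¹ * absMoment 1 K (symplFourier n θ a) := by
  have hR0 : 0 < (R : ℝ) := zero_lt_one.trans_le hR
  have h := Measure.integral_comp_smul (volume : Measure (Space n))
    (fun y => ‖(R : ℝ)⁻¹ • y‖ ^ 1 * (1 + ‖(R : ℝ)⁻¹ • y‖) ^ K * ‖symplFourier n θ a y‖) (R : ℝ)
  have hpos : 0 < (R : ℝ) ^ Module.finrank ℝ (Space n) := by positivity
  rw [abs_of_pos (inv_pos.2 hpos), smul_eq_mul, eq_inv_mul_iff_mul_eq₀ hpos.ne'] at h
  have h2 : absMoment 1 K (symplFourier n θ (dilate R a)) =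
      ∫ y, ‖(R : ℝ)⁻¹ • y‖ ^ 1 * (1 + ‖(R : ℝ)⁻¹ • y‖) ^ K * ‖symplFourier n θ a y‖ := by
    rw [← h, absMoment, ← integral_const_mul]
    congr 1
    funext y
    rw [symplFourier_dilate, norm_smul, Real.norm_eq_abs, abs_abs, abs_of_pos hpos, smul_smul,
      inv_mul_cancel₀ hR0.ne', one_smul]
    ring
  rw [h2, absMoment, ← integral_const_mul]
  refine integral_mono_of_nonneg (.of_forall fun y => by positivity)
    ((integrable_absMoment 1 K (symplFourier n θ a)).const_mul _) (.of_forall fun y => ?_)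
  have h3 : ‖(R : ℝ)⁻¹ • y‖ = (R : ℝ)⁻¹ * ‖y‖ := by
    rw [norm_smul, Real.norm_of_nonneg (inv_nonneg.2 hR0.le)]
  have h4 : (R : ℝ)⁻¹ * ‖y‖ ≤ ‖y‖ := by
    have := inv_le_one_of_one_le₀ hR
    nlinarith [norm_nonneg y]
  simp only [h3, pow_one]
  calc _ ≤ (R : ℝ)⁻¹ * ‖y‖ * (1 + ‖y‖) ^ K * ‖symplFourier n θ a y‖ := by gcongr
    _ = _ := by ring

theorem moyalStar_eq_osc (a b : 𝓢(Space n, ℂ)) :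
    (moyalStar n θ a b : Space n → ℂ) = (moyalConst n θ : ℂ) •
      osc ((2 * Real.pi) • (momentumMap n θ : Space n →L[ℝ] Space n))
        (ContinuousLinearMap.mul ℝ ℂ) a (symplFourier n θ b) := by
  funext x
  rw [moyalStar_apply, Pi.smul_apply, smul_eq_mul, osc]
  congr 2
  funext y
  have h : inner ℝ (((2 * Real.pi) • (momentumMap n θ : Space n →L[ℝ] Space n)) y) x =
      2 * thetaInvForm n θ y x := by
    change inner ℝ ((2 * Real.pi) • momentumMap n θ y) x = _
    rw [real_inner_smul_left, inner_momentumMap]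
    field_simp
  rw [h, ContinuousLinearMap.mul_apply', smul_eq_mul, mul_assoc]
  rfl

/-- Inversion at the origin gives `c ∫ b̂ = b(0)`, which identifies the subtracted term as `b(0) a`.
-/
theorem seminorm_moyalStar_sub_le (a : 𝓢(Space n, ℂ)) (k m : ℕ) :
    ∃ (C : ℝ) (K : ℕ), 0 ≤ C ∧ ∀ b : 𝓢(Space n, ℂ),
      SchwartzMap.seminorm ℝ k m (moyalStar n θ a b - b 0 • a) ≤
        C * absMoment 1 K (symplFourier n θ b) := by
  set N := (2 * Real.pi) • (momentumMap n θ : Space n →L[ℝ] Space n)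
  obtain ⟨C, K, hC, h⟩ := osc_sub_norm_le N k m (ContinuousLinearMap.mul ℝ ℂ) a
  have h0 := (moyalConst_pos n θ).le
  refine ⟨moyalConst n θ * C, K, by positivity, fun b => ?_⟩
  refine SchwartzMap.seminorm_le_bound ℝ k m _
    (mul_nonneg (by positivity) (absMoment_nonneg _ _ _)) fun x => ?_
  have h1 : ((moyalStar n θ a b - b 0 • a : 𝓢(Space n, ℂ)) : Space n → ℂ) =
      (moyalConst n θ : ℂ) • (osc N (ContinuousLinearMap.mul ℝ ℂ) a (symplFourier n θ b) -
        fun x => ContinuousLinearMap.mul ℝ ℂ (a x) (∫ y, symplFourier n θ b y)) := by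
    have h2 := symplFourier_inversion n θ b 0
    simp only [thetaInvForm_zero_right, mul_zero, phase_zero, one_mul] at h2
    rw [smul_sub, ← moyalStar_eq_osc, ← h2]
    funext x
    simp only [Pi.sub_apply, Pi.smul_apply, ContinuousLinearMap.mul_apply', smul_eq_mul,
      Complex.real_smul, sub_apply, smul_apply]
    ring
  have hc : ContDiff ℝ m (osc N (ContinuousLinearMap.mul ℝ ℂ) a (symplFourier n θ b) -
      fun x => ContinuousLinearMap.mul ℝ ℂ (a x) (∫ y, symplFourier n θ b y)) := by
    refine (osc_contDiff N m _ a _).sub ?_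
    exact ((ContinuousLinearMap.mul ℝ ℂ).flip _).contDiff.comp (a.smooth m)
  rw [h1, iteratedFDeriv_const_smul_apply hc.contDiffAt, norm_smul, Complex.norm_real,
    Real.norm_of_nonneg h0, mul_left_comm, mul_assoc]
  exact mul_le_mul_of_nonneg_left (h _ _) h0

theorem exists_schwartz_apply_zero_eq_one (n : ℕ) : ∃ φ : 𝓢(Space n, ℂ), φ 0 = 1 := by
  let f : ContDiffBump (0 : Space n) := ⟨1, 2, one_pos, one_lt_two⟩
  have h1 : HasCompactSupport fun x => ((f x : ℝ) : ℂ) :=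
    f.hasCompactSupport.comp_left (g := Complex.ofReal) Complex.ofReal_zero
  have h2 : ContDiff ℝ ∞ fun x => ((f x : ℝ) : ℂ) := Complex.ofRealCLM.contDiff.comp f.contDiff
  refine ⟨h1.toSchwartzMap h2, ?_⟩
  change ((f 0 : ℝ) : ℂ) = 1
  rw [f.one_of_mem_closedBall (Metric.mem_closedBall_self zero_le_one), Complex.ofReal_one]

theorem exists_right_approxUnit : ∃ e : ℕ → 𝓢(Space n, ℂ), ∀ a,
    Filter.Tendsto (fun j => moyalStar n θ a (e j)) Filter.atTop (nhds a) := by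
  obtain ⟨φ, hφ⟩ := exists_schwartz_apply_zero_eq_one n
  -- The shift by one keeps `R j ≥ 1`, as the moment estimate requires.
  let R : ℕ → ℝˣ := fun j => Units.mk0 ((j : ℝ) + 1) (by positivity)
  refine ⟨fun j => dilate (R j) φ, fun a =>
    ((schwartz_withSeminorms ℝ (Space n) ℂ).tendsto_nhds _ _).2 fun ⟨k, m⟩ ε hε => ?_⟩
  obtain ⟨C, K, hC, h⟩ := seminorm_moyalStar_sub_le θ a k m
  have hlim : Filter.Tendsto (fun j : ℕ => C * (((j : ℝ) + 1)⁻¹ *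
      absMoment 1 K (symplFourier n θ φ))) Filter.atTop (nhds 0) := by
    have := (tendsto_one_div_add_atTop_nhds_zero_nat (𝕜 := ℝ)).mul_const
      (absMoment 1 K (symplFourier n θ φ))
    simpa using this.const_mul C
  filter_upwards [hlim.eventually (gt_mem_nhds hε)] with j hj
  refine lt_of_le_of_lt ?_ hj
  have h1 := h (dilate (R j) φ)
  rw [dilate_apply, smul_zero, hφ, one_smul] at h1
  refine h1.trans ?_
  gcongr
  exact absMoment_symplFourier_dilate_le θ (R j)
    (by change (1 : ℝ) ≤ (j : ℝ) + 1; linarith [(Nat.cast_nonneg j : (0 : ℝ) ≤ j)]) K φ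

theorem eq_of_forall_moyalStar {T S : 𝓢(Space n, ℂ) → ℂ} (hT : Continuous T) (hS : Continuous S)
    (h : ∀ a b, T (moyalStar n θ a b) = S (moyalStar n θ a b)) : T = S := by
  obtain ⟨e, he⟩ := exists_right_approxUnit (n := n) θ
  funext a
  refine tendsto_nhds_unique ((hT.tendsto _).comp (he a)) ?_
  simpa only [Function.comp_def, h] using (hS.tendsto _).comp (he a)

end ApproxUnit

/-! ### The Moyal algebra -/

section MoyalAlgebra

variable {n : ℕ} {θ : ℝ} [NeZero θ]

theorem toDist_apply (a b : 𝓢(Space n, ℂ)) : toDist a b = ∫ x, a x * b x := by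
  refine (SchwartzMap.toTemperedDistributionCLM_apply_apply volume a b).trans ?_
  simp only [smul_eq_mul, mul_comm]

theorem toDist_comm (a b : 𝓢(Space n, ℂ)) : toDist a b = toDist b a := by
  simp only [toDist_apply, mul_comm]

theorem oneDist_apply (a : 𝓢(Space n, ℂ)) : oneDist n a = ∫ x, a x :=
  Measure.toTemperedDistribution_apply volume a

theorem toDist_eq_integral_moyalStar (a b : 𝓢(Space n, ℂ)) :
    toDist a b = ∫ x, moyalStar n θ a b x := by
  rw [toDist_apply, integral_moyalStar]

theorem toDist_moyalStar_left (a b c : 𝓢(Space n, ℂ)) :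
    toDist (moyalStar n θ a b) c = toDist a (moyalStar n θ b c) := by
  rw [toDist_eq_integral_moyalStar (θ := θ), toDist_eq_integral_moyalStar (θ := θ),
    moyalStar_assoc]

theorem toDist_moyalStar_right (a b c : 𝓢(Space n, ℂ)) :
    toDist (moyalStar n θ a b) c = toDist b (moyalStar n θ c a) := by
  rw [toDist_comm, ← toDist_moyalStar_left, toDist_comm]

/-- Pairing `a - b` with its conjugate gives `∫ |a - b|² = 0`, and continuity removes the
exceptional null set. Hence `T ⋆ a`, as a Schwartz function, is unique. -/
theorem toDist_injective : Function.Injective (toDist : 𝓢(Space n, ℂ) → 𝓢'(Space n, ℂ)) := by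
  intro a b h
  have h1 : toDist (a - b) (schwartzConj (a - b)) = 0 := by
    have : toDist (a - b) = toDist a - toDist b := by simp only [toDist, map_sub]
    rw [this, h, sub_self]
    rfl
  have h2 : ∫ x, Complex.normSq ((a - b) x) = 0 := by
    rw [toDist_apply] at h1
    simp only [schwartzConj_apply, Complex.mul_conj] at h1
    rw [integral_complex_ofReal] at h1
    exact_mod_cast h1
  have hc : Continuous fun x => Complex.normSq ((a - b) x) :=
    Complex.continuous_normSq.comp (a - b).continuous
  have hi : Integrable fun x => Complex.normSq ((a - b) x) := by
    have h3 := (SchwartzMap.pairing (ContinuousLinearMap.mul ℂ ℂ) (a - b)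
      (schwartzConj (a - b))).integrable (μ := volume)
    refine h3.re.congr (.of_forall fun x => ?_)
    simp only [SchwartzMap.pairing_apply_apply, schwartzConj_apply,
      ContinuousLinearMap.mul_apply', Complex.mul_conj]
    exact Complex.ofReal_re _
  have h4 := (integral_eq_zero_iff_of_nonneg (fun x => Complex.normSq_nonneg _) hi).1 h2
  have h5 := (hc.ae_eq_iff_eq volume continuous_const).1 h4
  ext x
  have h6 := Complex.normSq_eq_zero.1 (congrFun h5 x)
  exact sub_eq_zero.1 h6

open Classical in
/-- The Schwartz function `T ⋆ a`, for `T` in the Moyal algebra. -/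
def leftAct (θ : ℝ) [NeZero θ] (T : 𝓢'(Space n, ℂ)) (a : 𝓢(Space n, ℂ)) : 𝓢(Space n, ℂ) :=
  if h : ∃ c : 𝓢(Space n, ℂ), distStar n θ T a = toDist c then h.choose else 0

open Classical in
/-- The Schwartz function `a ⋆ T`, for `T` in the Moyal algebra. -/
def rightAct (θ : ℝ) [NeZero θ] (T : 𝓢'(Space n, ℂ)) (a : 𝓢(Space n, ℂ)) : 𝓢(Space n, ℂ) :=
  if h : ∃ c : 𝓢(Space n, ℂ), starDist n θ a T = toDist c then h.choose else 0

variable {T S U : 𝓢'(Space n, ℂ)}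

theorem distStar_eq_toDist (hT : T ∈ moyalAlgebra n θ) (a : 𝓢(Space n, ℂ)) :
    distStar n θ T a = toDist (leftAct θ T a) := by
  have h := hT.2 a
  rw [leftAct, dif_pos h]
  exact h.choose_spec

theorem toDist_leftAct (hT : T ∈ moyalAlgebra n θ) (a b : 𝓢(Space n, ℂ)) :
    toDist (leftAct θ T a) b = T (moyalStar n θ a b) := by
  rw [← distStar_eq_toDist hT, distStar_apply]

theorem toDist_rightAct (hT : T ∈ moyalAlgebra n θ) (a b : 𝓢(Space n, ℂ)) :
    toDist (rightAct θ T a) b = T (moyalStar n θ b a) := by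
  have h := hT.1 a
  rw [rightAct, dif_pos h, ← h.choose_spec, starDist_apply]

theorem mem_moyalAlgebra_of (L R : 𝓢(Space n, ℂ) → 𝓢(Space n, ℂ))
    (hL : ∀ a b, T (moyalStar n θ a b) = toDist (L a) b)
    (hR : ∀ a b, T (moyalStar n θ b a) = toDist (R a) b) : T ∈ moyalAlgebra n θ :=
  ⟨fun a => ⟨R a, by ext b; exact hR a b⟩, fun a => ⟨L a, by ext b; exact hL a b⟩⟩

theorem toDist_ext {a b : 𝓢(Space n, ℂ)} (h : ∀ c, toDist a c = toDist b c) : a = b :=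
  toDist_injective (by ext c; exact h c)

theorem leftAct_eq (hT : T ∈ moyalAlgebra n θ) {a c : 𝓢(Space n, ℂ)}
    (h : ∀ b, T (moyalStar n θ a b) = toDist c b) : leftAct θ T a = c :=
  toDist_ext fun b => (toDist_leftAct hT a b).trans (h b)

theorem rightAct_eq (hT : T ∈ moyalAlgebra n θ) {a c : 𝓢(Space n, ℂ)}
    (h : ∀ b, T (moyalStar n θ b a) = toDist c b) : rightAct θ T a = c :=
  toDist_ext fun b => (toDist_rightAct hT a b).trans (h b)

theorem leftAct_moyalStar (hT : T ∈ moyalAlgebra n θ) (a b : 𝓢(Space n, ℂ)) :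
    leftAct θ T (moyalStar n θ a b) = moyalStar n θ (leftAct θ T a) b :=
  leftAct_eq hT fun d => by rw [toDist_moyalStar_left, toDist_leftAct hT, moyalStar_assoc]

theorem rightAct_moyalStar (hT : T ∈ moyalAlgebra n θ) (a b : 𝓢(Space n, ℂ)) :
    rightAct θ T (moyalStar n θ b a) = moyalStar n θ b (rightAct θ T a) :=
  rightAct_eq hT fun d => by rw [toDist_moyalStar_right, toDist_rightAct hT, moyalStar_assoc]

/-- Both sides are the symmetric pairing of `S ⋆ b` with `a ⋆ T`. The right side is visibly
continuous in `b`, which the left is not. -/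
theorem apply_leftAct_moyalStar (hT : T ∈ moyalAlgebra n θ) (hS : S ∈ moyalAlgebra n θ)
    (a b : 𝓢(Space n, ℂ)) :
    T (moyalStar n θ (leftAct θ S b) a) = S (moyalStar n θ b (rightAct θ T a)) := by
  rw [← toDist_rightAct hT, toDist_comm, toDist_leftAct hS]

theorem exists_dist_eq_apply_leftAct (hT : T ∈ moyalAlgebra n θ) (hS : S ∈ moyalAlgebra n θ) :
    ∃ R : 𝓢'(Space n, ℂ), ∀ b, R b = T (leftAct θ S b) := by
  obtain ⟨e, he⟩ := exists_right_approxUnit (n := n) θ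
  let g : ℕ → 𝓢(Space n, ℂ) →L[ℂ] ℂ := fun j =>
    { toFun := fun b => S (moyalStar n θ b (rightAct θ T (e j)))
      map_add' := fun b c => map_add (starDist n θ (rightAct θ T (e j)) S) b c
      map_smul' := fun r b => map_smul (starDist n θ (rightAct θ T (e j)) S) r b
      cont := S.continuous.comp (starRight n θ (rightAct θ T (e j))).continuous }
  -- Pointwise convergence is enough: by Banach–Steinhaus on the barrelled space `𝓢`, the limit
  -- functional is continuous.
  have h : Filter.Tendsto (fun j b => g j b) Filter.atTop (nhds fun b => T (leftAct θ S b)) := by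
    refine tendsto_pi_nhds.2 fun b => ?_
    have h1 : ∀ j, g j b = T (moyalStar n θ (leftAct θ S b) (e j)) := fun j =>
      (apply_leftAct_moyalStar hT hS (e j) b).symm
    simp only [h1]
    exact (T.continuous.tendsto _).comp (he _)
  exact ⟨ContinuousLinearMap.toPointwiseConvergenceCLM ℂ (RingHom.id ℂ) 𝓢(Space n, ℂ) ℂ
    (continuousLinearMapOfTendsto g h), fun b => rfl⟩

theorem moyalMul_apply (hT : T ∈ moyalAlgebra n θ) (hS : S ∈ moyalAlgebra n θ)
    (b : 𝓢(Space n, ℂ)) : moyalMul n θ T S b = T (leftAct θ S b) := by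
  have h : ∃ R : 𝓢'(Space n, ℂ), ∀ b c : 𝓢(Space n, ℂ),
      distStar n θ S b = toDist c → R b = T c := by
    obtain ⟨R, hR⟩ := exists_dist_eq_apply_leftAct hT hS
    refine ⟨R, fun b c hc => ?_⟩
    rw [distStar_eq_toDist hS] at hc
    rw [hR, toDist_injective hc]
  rw [moyalMul, dif_pos h]
  exact h.choose_spec b _ (distStar_eq_toDist hS b)

theorem moyalMul_apply_moyalStar (hT : T ∈ moyalAlgebra n θ) (hS : S ∈ moyalAlgebra n θ)
    (a b : 𝓢(Space n, ℂ)) :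
    moyalMul n θ T S (moyalStar n θ a b) = toDist (leftAct θ T (leftAct θ S a)) b := by
  rw [moyalMul_apply hT hS, leftAct_moyalStar hS, toDist_leftAct hT]

theorem moyalMul_mem (hT : T ∈ moyalAlgebra n θ) (hS : S ∈ moyalAlgebra n θ) :
    moyalMul n θ T S ∈ moyalAlgebra n θ := by
  refine mem_moyalAlgebra_of (fun a => leftAct θ T (leftAct θ S a))
    (fun a => rightAct θ S (rightAct θ T a)) (moyalMul_apply_moyalStar hT hS) fun a b => ?_
  rw [moyalMul_apply hT hS, leftAct_moyalStar hS, apply_leftAct_moyalStar hT hS,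
    toDist_rightAct hS]

theorem leftAct_moyalMul (hT : T ∈ moyalAlgebra n θ) (hS : S ∈ moyalAlgebra n θ)
    (a : 𝓢(Space n, ℂ)) : leftAct θ (moyalMul n θ T S) a = leftAct θ T (leftAct θ S a) :=
  leftAct_eq (moyalMul_mem hT hS) (moyalMul_apply_moyalStar hT hS a)

theorem moyalMul_assoc (hT : T ∈ moyalAlgebra n θ) (hS : S ∈ moyalAlgebra n θ)
    (hU : U ∈ moyalAlgebra n θ) :
    moyalMul n θ (moyalMul n θ T S) U = moyalMul n θ T (moyalMul n θ S U) := by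
  ext b
  rw [moyalMul_apply (moyalMul_mem hT hS) hU, moyalMul_apply hT hS,
    moyalMul_apply hT (moyalMul_mem hS hU), leftAct_moyalMul hS hU]

theorem toDist_add (a b : 𝓢(Space n, ℂ)) : toDist (a + b) = toDist a + toDist b := by
  simp only [toDist, map_add]

theorem toDist_smul (r : ℂ) (a : 𝓢(Space n, ℂ)) : toDist (r • a) = r • toDist a := by
  simp only [toDist, map_smul]

theorem leftAct_add (hT : T ∈ moyalAlgebra n θ) (hS : S ∈ moyalAlgebra n θ)
    (a : 𝓢(Space n, ℂ)) : leftAct θ (T + S) a = leftAct θ T a + leftAct θ S a :=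
  leftAct_eq (add_mem hT hS) fun b => by
    rw [toDist_add]
    exact congrArg₂ (· + ·) (toDist_leftAct hT a b).symm (toDist_leftAct hS a b).symm

theorem leftAct_smul (r : ℂ) (hT : T ∈ moyalAlgebra n θ) (a : 𝓢(Space n, ℂ)) :
    leftAct θ (r • T) a = r • leftAct θ T a :=
  leftAct_eq (Submodule.smul_mem _ r hT) fun b => by
    rw [toDist_smul]
    exact congrArg (r * ·) (toDist_leftAct hT a b).symm

theorem moyalMul_add_left (hT : T ∈ moyalAlgebra n θ) (hS : S ∈ moyalAlgebra n θ)
    (hU : U ∈ moyalAlgebra n θ) :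
    moyalMul n θ (T + S) U = moyalMul n θ T U + moyalMul n θ S U := by
  ext b
  rw [moyalMul_apply (add_mem hT hS) hU]
  exact congrArg₂ (· + ·) (moyalMul_apply hT hU b).symm (moyalMul_apply hS hU b).symm

theorem moyalMul_add_right (hT : T ∈ moyalAlgebra n θ) (hS : S ∈ moyalAlgebra n θ)
    (hU : U ∈ moyalAlgebra n θ) :
    moyalMul n θ T (S + U) = moyalMul n θ T S + moyalMul n θ T U := by
  ext b
  rw [moyalMul_apply hT (add_mem hS hU), leftAct_add hS hU, map_add]
  exact congrArg₂ (· + ·) (moyalMul_apply hT hS b).symm (moyalMul_apply hT hU b).symm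

theorem moyalMul_smul_left (r : ℂ) (hT : T ∈ moyalAlgebra n θ) (hS : S ∈ moyalAlgebra n θ) :
    moyalMul n θ (r • T) S = r • moyalMul n θ T S := by
  ext b
  rw [moyalMul_apply (Submodule.smul_mem _ r hT) hS]
  exact congrArg (r * ·) (moyalMul_apply hT hS b).symm

theorem moyalMul_smul_right (r : ℂ) (hT : T ∈ moyalAlgebra n θ) (hS : S ∈ moyalAlgebra n θ) :
    moyalMul n θ T (r • S) = r • moyalMul n θ T S := by
  ext b
  rw [moyalMul_apply hT (Submodule.smul_mem _ r hS), leftAct_smul r hS, map_smul]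
  exact congrArg (r * ·) (moyalMul_apply hT hS b).symm

theorem moyalMul_zero_left (hS : S ∈ moyalAlgebra n θ) : moyalMul n θ 0 S = 0 := by
  simpa using moyalMul_smul_left 0 (zero_mem (moyalAlgebra n θ)) hS

theorem moyalMul_zero_right (hT : T ∈ moyalAlgebra n θ) : moyalMul n θ T 0 = 0 := by
  simpa using moyalMul_smul_right 0 hT (zero_mem (moyalAlgebra n θ))

theorem oneDist_moyalStar (a b : 𝓢(Space n, ℂ)) :
    oneDist n (moyalStar n θ a b) = toDist a b := by
  rw [oneDist_apply, toDist_eq_integral_moyalStar (θ := θ)]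

theorem oneDist_mem (n : ℕ) (θ : ℝ) [NeZero θ] : oneDist n ∈ moyalAlgebra n θ :=
  mem_moyalAlgebra_of (θ := θ) id id oneDist_moyalStar fun a b => by
    rw [oneDist_moyalStar, toDist_comm, id]

theorem moyalMul_one (hT : T ∈ moyalAlgebra n θ) : moyalMul n θ T (oneDist n) = T := by
  ext b
  rw [moyalMul_apply hT (oneDist_mem n θ),
    leftAct_eq (oneDist_mem n θ) (fun c => oneDist_moyalStar b c)]

theorem dist_eq_of_forall_moyalStar
    (h : ∀ a b, T (moyalStar n θ a b) = S (moyalStar n θ a b)) : T = S :=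
  DFunLike.coe_injective (eq_of_forall_moyalStar θ T.continuous S.continuous h)

/-- The claim `∫ T ⋆ b = ⟨T, b⟩` is accessible only for `b` a star product, where it is the trace
identity; density does the rest. -/
theorem one_moyalMul (hT : T ∈ moyalAlgebra n θ) : moyalMul n θ (oneDist n) T = T := by
  refine dist_eq_of_forall_moyalStar (θ := θ) fun a b => ?_
  rw [moyalMul_apply (oneDist_mem n θ) hT, leftAct_moyalStar hT, oneDist_moyalStar,
    toDist_leftAct hT]

theorem conj_toDist (a b : 𝓢(Space n, ℂ)) :
    conj (toDist a b) = toDist (schwartzConj a) (schwartzConj b) := by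
  simp only [toDist_apply, conj_integral_eq, map_mul, schwartzConj_apply]

theorem distConj_moyalStar_left (hT : T ∈ moyalAlgebra n θ) (a b : 𝓢(Space n, ℂ)) :
    distConj T (moyalStar n θ a b) =
      toDist (schwartzConj (rightAct θ T (schwartzConj a))) b := by
  rw [distConj_apply, schwartzConj_moyalStar, ← toDist_rightAct hT, conj_toDist,
    schwartzConj_schwartzConj]

theorem distConj_moyalStar_right (hT : T ∈ moyalAlgebra n θ) (a b : 𝓢(Space n, ℂ)) :
    distConj T (moyalStar n θ b a) =
      toDist (schwartzConj (leftAct θ T (schwartzConj a))) b := by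
  rw [distConj_apply, schwartzConj_moyalStar, ← toDist_leftAct hT, conj_toDist,
    schwartzConj_schwartzConj]

theorem distConj_mem (hT : T ∈ moyalAlgebra n θ) : distConj T ∈ moyalAlgebra n θ :=
  mem_moyalAlgebra_of _ _ (distConj_moyalStar_left hT) (distConj_moyalStar_right hT)

/-- On `a ⋆ b` both sides become the conjugate of `⟨S, b̄ ⋆ (ā ⋆ T)⟩`. -/
theorem distConj_moyalMul (hT : T ∈ moyalAlgebra n θ) (hS : S ∈ moyalAlgebra n θ) :
    distConj (moyalMul n θ T S) = moyalMul n θ (distConj S) (distConj T) := by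
  refine dist_eq_of_forall_moyalStar (θ := θ) fun a b => ?_
  rw [moyalMul_apply (distConj_mem hS) (distConj_mem hT),
    leftAct_eq (distConj_mem hT) (distConj_moyalStar_left hT _), distConj_apply, distConj_apply,
    schwartzConj_schwartzConj, moyalMul_apply hT hS, schwartzConj_moyalStar,
    leftAct_moyalStar hS, apply_leftAct_moyalStar hT hS, rightAct_moyalStar hT]

theorem distConj_add (T S : 𝓢'(Space n, ℂ)) : distConj (T + S) = distConj T + distConj S := by
  ext a
  exact map_add (starRingEnd ℂ) (T (schwartzConj a)) (S (schwartzConj a))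

theorem distConj_smul (r : ℂ) (T : 𝓢'(Space n, ℂ)) :
    distConj (r • T) = conj r • distConj T := by
  ext a
  exact map_mul (starRingEnd ℂ) r (T (schwartzConj a))

theorem distConj_distConj (T : 𝓢'(Space n, ℂ)) : distConj (distConj T) = T := by
  ext a
  rw [distConj_apply, distConj_apply, schwartzConj_schwartzConj, Complex.conj_conj]

end MoyalAlgebra

/-! ### The centre of the Moyal algebra -/

section Centre

variable {n : ℕ} {θ : ℝ} [NeZero θ]

theorem toDist_mem (θ : ℝ) [NeZero θ] (a : 𝓢(Space n, ℂ)) : toDist a ∈ moyalAlgebra n θ :=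
  mem_moyalAlgebra_of (θ := θ) (fun b => moyalStar n θ a b) (fun b => moyalStar n θ b a)
    (fun b c => (toDist_moyalStar_left a b c).symm)
    (fun b c => (toDist_moyalStar_right b a c).symm)

theorem toDist_modulate_translate (h : Space n) (a b : 𝓢(Space n, ℂ)) :
    toDist (modulate θ h (translate h a)) b = toDist a (modulate θ h (translate (-h) b)) := by
  rw [toDist_apply, toDist_apply, ← integral_add_right_eq_self
    (μ := (volume : Measure (Space n)))
    (fun x => a x * modulate θ h (translate (-h) b) x) h]
  congr 1
  funext x
  simp only [modulate_apply, translate_apply, add_neg_cancel_right, thetaInvForm_add_right,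
    thetaInvForm_self, add_zero]
  ring

theorem modulate_translate_comp_neg (h : Space n) (a : 𝓢(Space n, ℂ)) :
    modulate θ h (translate h (modulate θ h (translate (-h) a))) = modulate θ ((2 : ℝ) • h) a := by
  ext x
  simp only [modulate_apply, translate_apply, add_neg_cancel_right, thetaInvForm_add_right,
    thetaInvForm_self, add_zero, thetaInvForm_smul_left]
  rw [← mul_assoc, ← phase_add]
  ring_nf

/-- Opposite modulations cancel and the translations add. The inner operator keeps the form `-(-h)`
to match left multiplication by the plane wave of `-h`. -/
theorem modulate_translate_comp (h : Space n) (a : 𝓢(Space n, ℂ)) :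
    modulate θ h (translate h (modulate θ (-h) (translate (-(-h)) a))) =
      translate ((2 : ℝ) • h) a := by
  ext x
  simp only [modulate_apply, translate_apply, thetaInvForm_add_right, thetaInvForm_neg_left,
    thetaInvForm_self, neg_zero, add_zero, neg_neg]
  rw [← mul_assoc, ← phase_add, two_smul, add_assoc]
  simp

theorem symplFourier_injective : Function.Injective (symplFourier n θ) := fun a b h => by
  ext x
  rw [← symplFourier_inversion n θ a, h, symplFourier_inversion n θ b]

section Commuting

variable {T : 𝓢'(Space n, ℂ)} (hT : T ∈ moyalAlgebra n θ)
  (hc : ∀ a b, T (moyalStar n θ a b) = T (moyalStar n θ b a))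

include hT

theorem leftAct_modulate_translate (h : Space n) (a : 𝓢(Space n, ℂ)) :
    leftAct θ T (modulate θ h (translate h a)) = modulate θ h (translate h (leftAct θ T a)) :=
  leftAct_eq hT fun b => by
    rw [modulate_translate_moyalStar, toDist_modulate_translate, toDist_leftAct hT]

include hc

/-- Centrality enters here: commuting the factors under `T` turns left multiplication by a plane
wave into right multiplication, and back. -/
theorem leftAct_modulate_translate_neg (h : Space n) (a : 𝓢(Space n, ℂ)) :
    leftAct θ T (modulate θ h (translate (-h) a)) =
      modulate θ h (translate (-h) (leftAct θ T a)) :=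
  leftAct_eq hT fun b => by
    rw [hc, ← modulate_translate_moyalStar, hc, ← toDist_leftAct hT, toDist_comm,
      toDist_modulate_translate, toDist_comm]

theorem leftAct_modulate (h : Space n) (a : 𝓢(Space n, ℂ)) :
    leftAct θ T (modulate θ h a) = modulate θ h (leftAct θ T a) := by
  have h2 : h = (2 : ℝ) • ((2 : ℝ)⁻¹ • h) := by simp
  rw [h2, ← modulate_translate_comp_neg, leftAct_modulate_translate hT,
    leftAct_modulate_translate_neg hT hc, modulate_translate_comp_neg]

theorem leftAct_translate (h : Space n) (a : 𝓢(Space n, ℂ)) :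
    leftAct θ T (translate h a) = translate h (leftAct θ T a) := by
  have h2 : h = (2 : ℝ) • ((2 : ℝ)⁻¹ • h) := by simp
  rw [h2, ← modulate_translate_comp (θ := θ), leftAct_modulate_translate hT,
    leftAct_modulate_translate_neg hT hc, modulate_translate_comp]

/-- Both products have the same symplectic transform. For a plane wave `u`, `∫ u (T ⋆ a) b = ⟨T ⋆
(ua), b⟩ = ⟨T, (ua) ⋆ b⟩`, and centrality makes the last expression symmetric in `ua` and `b`. -/
theorem leftAct_mul_eq (a b : 𝓢(Space n, ℂ)) (x : Space n) :
    leftAct θ T a x * b x = a x * leftAct θ T b x := by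
  have h : SchwartzMap.pairing (ContinuousLinearMap.mul ℂ ℂ) (leftAct θ T a) b =
      SchwartzMap.pairing (ContinuousLinearMap.mul ℂ ℂ) a (leftAct θ T b) := by
    refine symplFourier_injective (θ := θ) ?_
    ext y
    rw [symplFourier_apply, symplFourier_apply]
    simp only [SchwartzMap.pairing_apply_apply, ContinuousLinearMap.mul_apply']
    have e1 : ∀ f g : 𝓢(Space n, ℂ), ∫ z, phase (-2 * thetaInvForm n θ y z) * (f z * g z) =
        toDist (modulate θ (-y) f) g := fun f g => by
      rw [toDist_apply]
      congr 1
      funext z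
      rw [modulate_apply, thetaInvForm_neg_left]
      ring_nf
    rw [e1, e1, ← leftAct_modulate hT hc, toDist_leftAct hT, hc, ← toDist_leftAct hT,
      toDist_comm]
  exact congrArg (fun f : 𝓢(Space n, ℂ) => f x) h

theorem exists_leftAct_eq_smul : ∃ c : ℂ, ∀ a, leftAct θ T a = c • a := by
  obtain ⟨φ, hφ⟩ := exists_schwartz_apply_zero_eq_one n
  refine ⟨leftAct θ T φ 0, fun a => ?_⟩
  ext x
  -- Testing against `φ` centred at `x` gives `(T ⋆ a)(x) = a(x) (T ⋆ φ)(0)`, with a factor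
  -- independent of `x`.
  have h := leftAct_mul_eq hT hc a (translate (-x) φ) x
  rw [leftAct_translate hT hc, translate_apply, translate_apply, add_neg_cancel, hφ,
    mul_one] at h
  rw [h, smul_apply, smul_eq_mul, mul_comm]

theorem exists_eq_smul_oneDist : ∃ c : ℂ, T = c • oneDist n := by
  obtain ⟨c, h⟩ := exists_leftAct_eq_smul hT hc
  refine ⟨c, dist_eq_of_forall_moyalStar (θ := θ) fun a b => ?_⟩
  rw [← toDist_leftAct hT, h, toDist_smul]
  exact congrArg (c * ·) (oneDist_moyalStar a b).symm

end Commuting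

theorem exists_eq_smul_oneDist_of_commute {T : 𝓢'(Space n, ℂ)} (hT : T ∈ moyalAlgebra n θ)
    (hc : ∀ S ∈ moyalAlgebra n θ, moyalMul n θ T S = moyalMul n θ S T) :
    ∃ c : ℂ, T = c • oneDist n := by
  refine exists_eq_smul_oneDist hT fun a b => ?_
  have h := congrArg (fun R : 𝓢'(Space n, ℂ) => R b) (hc (toDist a) (toDist_mem θ a))
  simp only [moyalMul_apply hT (toDist_mem θ a), moyalMul_apply (toDist_mem θ a) hT] at h
  rw [leftAct_eq (toDist_mem θ a) (fun d => (toDist_moyalStar_left a b d).symm)] at h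
  rw [h, toDist_comm, toDist_leftAct hT]

end Centre

/-! ### The graded algebra -/

section Graded

variable {n : ℕ} {θ : ℝ} [NeZero θ]

theorem zmod_two_cases (i : ZMod 2) : i = 0 ∨ i = 1 := by
  fin_cases i
  exacts [Or.inl rfl, Or.inr rfl]

theorem mem_superGrading_zero {a : 𝓢'(Space n, ℂ) × 𝓢'(Space n, ℂ)} :
    a ∈ superGrading n θ 0 ↔ a.1 ∈ moyalAlgebra n θ ∧ a.2 = 0 := by
  simp [superGrading]

theorem mem_superGrading_one {a : 𝓢'(Space n, ℂ) × 𝓢'(Space n, ℂ)} :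
    a ∈ superGrading n θ 1 ↔ a.1 = 0 ∧ a.2 ∈ moyalAlgebra n θ := by
  simp [superGrading]

theorem mem_superMoyal {a : 𝓢'(Space n, ℂ) × 𝓢'(Space n, ℂ)} :
    a ∈ superMoyal n θ ↔ a.1 ∈ moyalAlgebra n θ ∧ a.2 ∈ moyalAlgebra n θ := Iff.rfl

theorem superGrading_le (i : ZMod 2) : superGrading n θ i ≤ superMoyal n θ := by
  intro a ha
  rcases zmod_two_cases i with rfl | rfl
  · rw [mem_superGrading_zero] at ha
    exact ⟨ha.1, by rw [ha.2]; exact zero_mem _⟩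
  · rw [mem_superGrading_one] at ha
    exact ⟨by rw [ha.1]; exact zero_mem _, ha.2⟩

theorem superGrading_iSup_eq : ⨆ i, superGrading n θ i = superMoyal n θ := by
  refine le_antisymm (iSup_le superGrading_le) fun a ha => ?_
  rw [show a = (a.1, 0) + (0, a.2) by simp]
  exact add_mem (Submodule.mem_iSup_of_mem 0 (mem_superGrading_zero.2 ⟨ha.1, rfl⟩))
    (Submodule.mem_iSup_of_mem 1 (mem_superGrading_one.2 ⟨rfl, ha.2⟩))

theorem superGrading_independent : iSupIndep (superGrading n θ) := by
  have h01 : Disjoint (superGrading n θ 0) (superGrading n θ 1) := by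
    rw [Submodule.disjoint_def]
    intro a h0 h1
    exact Prod.ext (mem_superGrading_one.1 h1).1 (mem_superGrading_zero.1 h0).2
  refine fun i => ?_
  rcases zmod_two_cases i with rfl | rfl
  · refine h01.mono_right (iSup₂_le fun j hj => ?_)
    rcases zmod_two_cases j with rfl | rfl
    exacts [absurd rfl hj, le_rfl]
  · refine h01.symm.mono_right (iSup₂_le fun j hj => ?_)
    rcases zmod_two_cases j with rfl | rfl
    exacts [le_rfl, absurd rfl hj]

theorem superMul_mem {a b : 𝓢'(Space n, ℂ) × 𝓢'(Space n, ℂ)} (ha : a ∈ superMoyal n θ)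
    (hb : b ∈ superMoyal n θ) : superMul n θ a b ∈ superMoyal n θ :=
  ⟨add_mem (moyalMul_mem ha.1 hb.1) (moyalMul_mem ha.2 hb.2),
    add_mem (moyalMul_mem ha.1 hb.2) (moyalMul_mem ha.2 hb.1)⟩

theorem superMul_mem_superGrading (i j : ZMod 2) {a b : 𝓢'(Space n, ℂ) × 𝓢'(Space n, ℂ)}
    (ha : a ∈ superGrading n θ i) (hb : b ∈ superGrading n θ j) :
    superMul n θ a b ∈ superGrading n θ (i + j) := by
  have h := superMul_mem (superGrading_le i ha) (superGrading_le j hb)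
  obtain ⟨a0, a1⟩ := a
  obtain ⟨b0, b1⟩ := b
  rcases zmod_two_cases i with rfl | rfl <;> rcases zmod_two_cases j with rfl | rfl
  · obtain ⟨ha, rfl : a1 = 0⟩ := mem_superGrading_zero.1 ha
    obtain ⟨hb, rfl : b1 = 0⟩ := mem_superGrading_zero.1 hb
    refine mem_superGrading_zero.2 ⟨h.1, ?_⟩
    simp only [superMul, moyalMul_zero_right ha, moyalMul_zero_left hb, add_zero]
  · obtain ⟨ha, rfl : a1 = 0⟩ := mem_superGrading_zero.1 ha
    obtain ⟨rfl : b0 = 0, hb⟩ := mem_superGrading_one.1 hb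
    refine mem_superGrading_one.2 ⟨?_, h.2⟩
    simp only [superMul, moyalMul_zero_right ha, moyalMul_zero_left hb, add_zero]
  · obtain ⟨rfl : a0 = 0, ha⟩ := mem_superGrading_one.1 ha
    obtain ⟨hb, rfl : b1 = 0⟩ := mem_superGrading_zero.1 hb
    refine mem_superGrading_one.2 ⟨?_, h.2⟩
    simp only [superMul, moyalMul_zero_right ha, moyalMul_zero_left hb, add_zero]
  · obtain ⟨rfl : a0 = 0, ha⟩ := mem_superGrading_one.1 ha
    obtain ⟨rfl : b0 = 0, hb⟩ := mem_superGrading_one.1 hb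
    refine mem_superGrading_zero.2 ⟨h.1, ?_⟩
    simp only [superMul, moyalMul_zero_right ha, moyalMul_zero_left hb, add_zero]

theorem superDagger_mem {a : 𝓢'(Space n, ℂ) × 𝓢'(Space n, ℂ)} (ha : a ∈ superMoyal n θ) :
    superDagger a ∈ superMoyal n θ :=
  ⟨distConj_mem ha.1, Submodule.smul_mem _ _ (distConj_mem ha.2)⟩

theorem distConj_zero : distConj (0 : 𝓢'(Space n, ℂ)) = 0 := by
  simpa using distConj_smul 0 (0 : 𝓢'(Space n, ℂ))

theorem superDagger_mem_superGrading (i : ZMod 2) {a : 𝓢'(Space n, ℂ) × 𝓢'(Space n, ℂ)}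
    (ha : a ∈ superGrading n θ i) : superDagger a ∈ superGrading n θ i := by
  have h := superDagger_mem (superGrading_le i ha)
  rcases zmod_two_cases i with rfl | rfl
  · refine mem_superGrading_zero.2 ⟨h.1, ?_⟩
    rw [superDagger, (mem_superGrading_zero.1 ha).2, distConj_zero, smul_zero]
  · refine mem_superGrading_one.2 ⟨?_, h.2⟩
    rw [superDagger, (mem_superGrading_one.1 ha).1, distConj_zero]

theorem superMul_assoc {a b c : 𝓢'(Space n, ℂ) × 𝓢'(Space n, ℂ)} (ha : a ∈ superMoyal n θ)
    (hb : b ∈ superMoyal n θ) (hc : c ∈ superMoyal n θ) :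
    superMul n θ (superMul n θ a b) c = superMul n θ a (superMul n θ b c) := by
  obtain ⟨ha0, ha1⟩ := mem_superMoyal.1 ha
  obtain ⟨hb0, hb1⟩ := mem_superMoyal.1 hb
  obtain ⟨hc0, hc1⟩ := mem_superMoyal.1 hc
  simp only [superMul, moyalMul_add_left, moyalMul_add_right, moyalMul_mem, moyalMul_assoc,
    ha0, ha1, hb0, hb1, hc0, hc1]
  refine Prod.ext ?_ ?_ <;> simp only <;> abel

theorem superDagger_superMul (i j : ZMod 2) {a b : 𝓢'(Space n, ℂ) × 𝓢'(Space n, ℂ)}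
    (ha : a ∈ superGrading n θ i) (hb : b ∈ superGrading n θ j) :
    superDagger (superMul n θ a b) =
      (-1 : ℂ) ^ (i.val * j.val) • superMul n θ (superDagger b) (superDagger a) := by
  obtain ⟨a0, a1⟩ := a
  obtain ⟨b0, b1⟩ := b
  obtain ⟨ha0, ha1⟩ := mem_superMoyal.1 (superGrading_le i ha)
  obtain ⟨hb0, hb1⟩ := mem_superMoyal.1 (superGrading_le j hb)
  simp only at ha0 ha1 hb0 hb1
  have hda := distConj_mem ha1
  have hdb := distConj_mem hb1
  have hIa := Submodule.smul_mem _ Complex.I hda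
  have hIb := Submodule.smul_mem _ Complex.I hdb
  have hl := moyalMul_smul_left Complex.I hdb hIa
  have hr := moyalMul_smul_right Complex.I hdb hda
  simp only [superDagger, superMul, distConj_add, distConj_moyalMul, ha0, ha1, hb0, hb1]
  rcases zmod_two_cases i with rfl | rfl <;> rcases zmod_two_cases j with rfl | rfl
  · obtain rfl : a1 = 0 := (mem_superGrading_zero.1 ha).2
    obtain rfl : b1 = 0 := (mem_superGrading_zero.1 hb).2
    simp [distConj_zero, moyalMul_zero_right, moyalMul_zero_left, distConj_mem, *]
  · obtain rfl : a1 = 0 := (mem_superGrading_zero.1 ha).2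
    obtain rfl : b0 = 0 := (mem_superGrading_one.1 hb).1
    simp [distConj_zero, moyalMul_zero_right, moyalMul_zero_left, moyalMul_smul_left,
      distConj_mem, *]
  · obtain rfl : a0 = 0 := (mem_superGrading_one.1 ha).1
    obtain rfl : b1 = 0 := (mem_superGrading_zero.1 hb).2
    simp [distConj_zero, moyalMul_zero_right, moyalMul_zero_left, moyalMul_smul_right,
      distConj_mem, *]
  · obtain rfl : a0 = 0 := (mem_superGrading_one.1 ha).1
    obtain rfl : b0 = 0 := (mem_superGrading_one.1 hb).1
    -- For two odd elements the two factors `i` of the involution multiply to `-1`, which cancels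
    -- the sign `(-1)^{|a||b|}`.
    rw [hl, hr, smul_smul, Complex.I_mul_I]
    simp [distConj_zero, moyalMul_zero_right, moyalMul_zero_left, ZMod.val_one, *]

theorem isGradedStarAlgebra_superMoyal (n : ℕ) (θ : ℝ) [NeZero θ] :
    IsGradedStarAlgebra (superMoyal n θ) (superGrading n θ) (superMul n θ) (superOne n)
      superDagger where
  iSup_eq := superGrading_iSup_eq
  independent := superGrading_independent
  mul_mem i j _ ha _ hb := superMul_mem_superGrading i j ha hb
  mul_mem' _ ha _ hb := superMul_mem ha hb
  add_mul a ha b hb c hc := by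
    simp only [superMul, Prod.fst_add, Prod.snd_add, moyalMul_add_left ha.1 hb.1 hc.1,
      moyalMul_add_left ha.1 hb.1 hc.2, moyalMul_add_left ha.2 hb.2 hc.1,
      moyalMul_add_left ha.2 hb.2 hc.2, Prod.mk_add_mk]
    refine Prod.ext ?_ ?_ <;> simp only <;> abel
  mul_add a ha b hb c hc := by
    simp only [superMul, Prod.fst_add, Prod.snd_add, moyalMul_add_right ha.1 hb.1 hc.1,
      moyalMul_add_right ha.1 hb.2 hc.2, moyalMul_add_right ha.2 hb.1 hc.1,
      moyalMul_add_right ha.2 hb.2 hc.2, Prod.mk_add_mk]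
    refine Prod.ext ?_ ?_ <;> simp only <;> abel
  smul_mul r a ha b hb := by
    simp only [superMul, Prod.smul_fst, Prod.smul_snd, moyalMul_smul_left r ha.1 hb.1,
      moyalMul_smul_left r ha.1 hb.2, moyalMul_smul_left r ha.2 hb.1,
      moyalMul_smul_left r ha.2 hb.2, Prod.smul_mk, smul_add]
  mul_smul r a ha b hb := by
    simp only [superMul, Prod.smul_fst, Prod.smul_snd, moyalMul_smul_right r ha.1 hb.1,
      moyalMul_smul_right r ha.1 hb.2, moyalMul_smul_right r ha.2 hb.1,
      moyalMul_smul_right r ha.2 hb.2, Prod.smul_mk, smul_add]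
  mul_assoc _ ha _ hb _ hc := superMul_assoc ha hb hc
  one_mem := mem_superGrading_zero.2 ⟨oneDist_mem n θ, rfl⟩
  one_mul a ha := by
    simp only [superMul, superOne, one_moyalMul ha.1, one_moyalMul ha.2, moyalMul_zero_left ha.1,
      moyalMul_zero_left ha.2, add_zero]
  mul_one a ha := by
    simp only [superMul, superOne, moyalMul_one ha.1, moyalMul_one ha.2,
      moyalMul_zero_right ha.1, moyalMul_zero_right ha.2, add_zero, zero_add]
  dag_mem i _ ha := superDagger_mem_superGrading i ha
  dag_mem' _ ha := superDagger_mem ha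
  dag_add a _ b _ := by
    simp only [superDagger, Prod.fst_add, Prod.snd_add, distConj_add, smul_add, Prod.mk_add_mk]
  dag_smul r a _ := by
    simp only [superDagger, Prod.smul_fst, Prod.smul_snd, distConj_smul, Prod.smul_mk,
      smul_comm Complex.I]
  dag_dag a _ := by
    simp only [superDagger, distConj_smul, distConj_distConj, smul_smul]
    simp
  dag_mul i j _ ha _ hb := superDagger_superMul i j ha hb

theorem superBracket_eq (a b : 𝓢'(Space n, ℂ) × 𝓢'(Space n, ℂ)) (ha : a ∈ superMoyal n θ)
    (hb : b ∈ superMoyal n θ) : superBracket n θ a b =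
      (moyalMul n θ a.1 b.1 - moyalMul n θ b.1 a.1 +
          (moyalMul n θ a.2 b.2 + moyalMul n θ b.2 a.2),
        moyalMul n θ a.1 b.2 - moyalMul n θ b.2 a.1 +
          (moyalMul n θ a.2 b.1 - moyalMul n θ b.1 a.2)) := by
  obtain ⟨ha1, ha2⟩ := mem_superMoyal.1 ha
  obtain ⟨hb1, hb2⟩ := mem_superMoyal.1 hb
  have h0 := zero_mem (moyalAlgebra n θ)
  have hs : ∀ f : ZMod 2 → 𝓢'(Space n, ℂ) × 𝓢'(Space n, ℂ), ∑ i, f i = f 0 + f 1 :=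
    fun f => Fin.sum_univ_two f
  simp only [superBracket, hs, superPart, superMul, if_true, one_ne_zero, if_false,
    moyalMul_zero_left, moyalMul_zero_right, ha1, ha2, hb1, hb2, h0, ZMod.val_zero,
    ZMod.val_one, mul_zero, pow_zero, pow_one, mul_one, one_smul, neg_smul, add_zero,
    zero_add]
  refine Prod.ext ?_ ?_ <;> simp

theorem superCenter_eq (n : ℕ) (θ : ℝ) [NeZero θ] :
    superCenter n θ = {a | ∃ c : ℂ, a = (c • oneDist n, 0)} := by
  have h0 := zero_mem (moyalAlgebra n θ)
  have h1 := oneDist_mem n θ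
  ext a
  constructor
  · rintro ⟨ha, h⟩
    obtain ⟨ha0, ha1⟩ := mem_superMoyal.1 ha
    -- The odd unit anticommutes with the odd part in the graded sense, so the even component of
    -- this bracket is `2 a₁`.
    have hodd := h (0, oneDist n) ⟨h0, h1⟩
    rw [superBracket_eq _ _ ha ⟨h0, h1⟩] at hodd
    simp only [moyalMul_zero_left, moyalMul_zero_right, ha0, ha1, moyalMul_one, one_moyalMul,
      sub_self, zero_add, Prod.mk_eq_zero] at hodd
    have ha2 : a.2 = 0 := by
      have h2 : (2 : ℂ) • a.2 = 0 := by rw [two_smul]; exact hodd.1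
      exact (smul_eq_zero.1 h2).resolve_left two_ne_zero
    obtain ⟨c, hc⟩ := exists_eq_smul_oneDist_of_commute ha.1 fun S hS => by
      have h2 := h (S, 0) ⟨hS, h0⟩
      rw [superBracket_eq _ _ ha ⟨hS, h0⟩] at h2
      simp only [moyalMul_zero_left, moyalMul_zero_right, ha0, ha1, add_zero,
        Prod.mk_eq_zero] at h2
      exact sub_eq_zero.1 h2.1
    exact ⟨c, Prod.ext hc ha2⟩
  · rintro ⟨c, rfl⟩
    have hc : c • oneDist n ∈ moyalAlgebra n θ := Submodule.smul_mem _ c h1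
    refine ⟨⟨hc, h0⟩, fun b hb => ?_⟩
    obtain ⟨hb0, hb1⟩ := mem_superMoyal.1 hb
    rw [superBracket_eq _ _ ⟨hc, h0⟩ hb]
    simp only [moyalMul_smul_left c h1 hb0, moyalMul_smul_left c h1 hb1,
      moyalMul_smul_right c hb0 h1, moyalMul_smul_right c hb1 h1, moyalMul_one, one_moyalMul,
      hb0, hb1, moyalMul_zero_left, moyalMul_zero_right, sub_self, add_zero]
    rfl

end Graded

end Moyal
end

theorem mainTheorem9 (n : ℕ) (θ : ℝ) [NeZero θ] :
    (∀ T ∈ Moyal.moyalAlgebra n θ, ∀ S ∈ Moyal.moyalAlgebra n θ,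
      Moyal.moyalMul n θ T S ∈ Moyal.moyalAlgebra n θ ∧
      ∀ b, ∃ c, Moyal.distStar n θ S b = Moyal.toDist c ∧ Moyal.moyalMul n θ T S b = T c) ∧
    Moyal.IsGradedStarAlgebra (Moyal.superMoyal n θ) (Moyal.superGrading n θ)
      (Moyal.superMul n θ) (Moyal.superOne n) Moyal.superDagger ∧
    Moyal.superCenter n θ = {a | ∃ c : ℂ, a = (c • Moyal.oneDist n, 0)} := by
  refine ⟨fun T hT S hS => ⟨Moyal.moyalMul_mem hT hS, fun b =>
    ⟨Moyal.leftAct θ S b, Moyal.distStar_eq_toDist hS b, Moyal.moyalMul_apply hT hS b⟩⟩,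
    Moyal.isGradedStarAlgebra_superMoyal n θ, Moyal.superCenter_eq n θ⟩
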